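/- Let $\mathbb K$ be an algebraically closed field of characteristic $0$, and let $p\in\mathbb K[x,y]\setminus(\mathbb K[x]\cup\mathbb K[y])$ be irreducible. Let $\mathbb K[x,y]_p\subset\mathbb K(x,y)$ be the ring of rational functions whose (reduced) denominator is not divisible by $p$, and $\langle p\rangle$ the ideal generated by $p$ in it. For $r\in\mathbb K(x,y)$ put $$\mathrm F(r,p)=\{(f,g)\in\mathbb K(x)\times\mathbb K(y): f-g\in r+\langle p\rangle\},\qquad \mathrm F(p)=\mathrm F(0,p),$$ and call $\mathrm F(p)$ non-trivial if it contains an element that is not of the form $(c,c)$ with $c\in\mathbb K$. For $s\in\mathbb K\cup\{\infty\}$ and $f\neq 0$ let $\mathrm m(s,f)$ be the negative of the order of $f$ at $s$ (and $\mathrm m(s,0)=0$), so that $s$ is a pole of $f$ if and only if $\mathrm m(s,f)>0$. Let $C\subset\mathbb P^1(\mathbb K)\times\mathbb P^1(\mathbb K)$ be the curve defined by the bi-homogenization of $p$. The orbits are the classes of the smallest equivalence relation on $C$ that relates any two points with the same first or the same second coordinate. A point $(s_1,s_2)\in C$ is a pole (respectively, a root) of $r$ on $C$ if there is a Puiseux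 series $\varphi$ in the local parameter at $s_1$ ($x-s_1$, or $x^{-1}$ if $s_1=\infty$) with $p(x,\varphi)=0$ whose value at $s_1$ is $s_2$ and for which $r(x,\varphi)$ has negative (respectively, positive) order. Let $r\in\mathbb K[x,y]_p\setminus\langle p\rangle$, and assume that $\mathrm F(r,p)\neq\emptyset$ and that $\mathrm F(p)$ is non-trivial. Then: 1. There is an $(f,g)\in\mathrm F(r,p)$ such that every pole of $f$ is the first coordinate, and every pole of $g$ is the second coordinate, of some point of $C$ that lies in the orbit of a pole or a root of $r$ on $C$. 2. Let $(f_0,g_0)$ be a generator of $\mathrm F(p)$, that is, $\mathrm F(p)=\{(h(f_0),h(g_0)) : h \text{ a univariate rational function over } \mathbb K\}$. Let $(f,g)\in\mathrm F(r,p)$ and let $(s_1,s_2)\in C$ be such that $\mathrm m(s_1,f_0)>0$, and $\mathrm m(s_1,f)\leq 0$ or $\mathrm m(s_1,f_0)\nmid\mathrm m(s_1,f)$. If, for some point $(t_1,t_2)$ in the orbit of $(s_1,s_2)$, $t_1$ is a pole of $f$ or $t_2$ is a pole of $g$, then this orbit contains a pole or a root of $r$ on $C$. -/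

import Mathlib

open scoped OnePoint

noncomputable section

namespace SeparatedVariables

variable {K : Type*} [Field K]

/-- The polynomial ring `K[x,y]`; `x` is the variable `0` and `y` is the variable `1`. -/
abbrev Poly₂ (K : Type*) [Field K] : Type _ := MvPolynomial (Fin 2) K

/-- The field of rational functions `K(x,y)`. -/
abbrev Rat₂ (K : Type*) [Field K] : Type _ := FractionRing (MvPolynomial (Fin 2) K)

/-- Substituting one of the two variables into a univariate polynomial. -/
def polyIn (K : Type*) [Field K] (i : Fin 2) : Polynomial K →ₐ[K] Rat₂ K :=
  Polynomial.aeval (algebraMap (Poly₂ K) (Rat₂ K) (MvPolynomial.X i))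

theorem polyIn_injective (K : Type*) [Field K] (i : Fin 2) :
    Function.Injective (polyIn K i) := by
  have h : Transcendental K (algebraMap (Poly₂ K) (Rat₂ K) (MvPolynomial.X i)) :=
    (transcendental_algebraMap_iff (IsFractionRing.injective (Poly₂ K) (Rat₂ K))).2
      (MvPolynomial.transcendental_X K i)
  exact transcendental_iff_injective.1 h

/-- The embedding of `K(x)` (for `i = 0`) or `K(y)` (for `i = 1`) into `K(x,y)`. -/
def ratIn (K : Type*) [Field K] (i : Fin 2) : RatFunc K →ₐ[K] Rat₂ K :=
  RatFunc.liftAlgHom (polyIn K i)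
    (nonZeroDivisors_le_comap_nonZeroDivisors_of_injective _ (polyIn_injective K i))

/-- The numerator of a rational function in reduced form. -/
abbrev numer (r : Rat₂ K) : Poly₂ K := IsFractionRing.num (Poly₂ K) r

/-- The denominator of a rational function in reduced form. -/
abbrev denom (r : Rat₂ K) : Poly₂ K := IsFractionRing.den (Poly₂ K) r

/-- The local ring of `K[x,y]` at `p`: the denominator is not divisible by `p`. -/
def localRing (p : Poly₂ K) : Set (Rat₂ K) := {r | ¬ p ∣ denom r}

/-- The ideal generated by `p` in the local ring of `K[x,y]` at `p`. -/
def idealOf (p : Poly₂ K) : Set (Rat₂ K) :=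
  {r | ∃ q ∈ localRing p, r = q * algebraMap (Poly₂ K) (Rat₂ K) p}

/-- `F(r,p)`: the pairs `(f,g)` in `K(x) × K(y)` with `f - g ∈ r + ⟨p⟩`. -/
def F (r : Rat₂ K) (p : Poly₂ K) : Set (RatFunc K × RatFunc K) :=
  {fg | ratIn K 0 fg.1 - ratIn K 1 fg.2 - r ∈ idealOf p}

/-- `F(p) = F(0,p)` is non-trivial: it contains more than the constants `(c,c)`. -/
def FNontrivial (p : Poly₂ K) : Prop :=
  ∃ fg ∈ F 0 p, ¬ ∃ c : K, fg = (RatFunc.C c, RatFunc.C c)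

/-- `F(p) = K((f₀,g₀))`: the elements of `F(p)` are the rational functions in `(f₀,g₀)`. -/
def IsGenerator (p : Poly₂ K) (fg₀ : RatFunc K × RatFunc K) : Prop :=
  F 0 p = Set.range fun h : RatFunc K =>
    (h.eval RatFunc.C fg₀.1, h.eval RatFunc.C fg₀.2)

/-- `m(s,f)`: the negative of the order of `f` at `s ∈ K ∪ {∞}`. For non-zero `f` it is positive
if and only if `s` is a pole, and it then is the multiplicity of the pole. (It is `0` for `f = 0`.) -/
def mult (s : OnePoint K) (f : RatFunc K) : ℤ :=
  s.elim f.intDegree fun a => (f.denom.rootMultiplicity a : ℤ) - f.num.rootMultiplicity a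

/-- `s` is a pole of the univariate rational function `f`. -/
def IsPoleOf (s : OnePoint K) (f : RatFunc K) : Prop := 0 < mult s f

/-- Homogeneous coordinates `[s₀ : s₁]` of a point `s = s₁ / s₀` of the projective line. -/
def hom₀ (s : OnePoint K) : K := s.elim 0 fun _ => 1

/-- See `hom₀`. -/
def hom₁ (s : OnePoint K) : K := s.elim 1 fun a => a

/-- The curve in `ℙ¹ × ℙ¹` given by the bi-homogenization of `p`. -/
def curve (p : Poly₂ K) : Set (OnePoint K × OnePoint K) :=
  {P | ∑ m ∈ p.support, p.coeff m *
      (hom₀ P.1 ^ (p.degreeOf 0 - m 0) * hom₁ P.1 ^ m 0) *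
      (hom₀ P.2 ^ (p.degreeOf 1 - m 1) * hom₁ P.2 ^ m 1) = 0}

/-- Two points of the curve lie in the same orbit: the smallest equivalence relation on the curve
that relates any two points with a common first or a common second coordinate. -/
def SameOrbit (p : Poly₂ K) : curve p → curve p → Prop :=
  Relation.EqvGen fun P Q => P.1.1 = Q.1.1 ∨ P.1.2 = Q.1.2

/-- The coordinate `x` near `s`, written in terms of `u`, the `n`-th root of the local parameter
at `s` (which is `x - s` if `s` is finite, and `x⁻¹` if `s = ∞`). -/
def coordAt (s : OnePoint K) (n : ℕ) : LaurentSeries K :=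
  s.elim (HahnSeries.single (-(n : ℤ)) 1) fun a => HahnSeries.C a + HahnSeries.single (n : ℤ) 1

/-- The series `φ` takes the value `s` at the origin of its parameter. -/
def CenteredAt (φ : LaurentSeries K) (s : OnePoint K) : Prop :=
  s.elim (φ.orderTop < 0) fun a => 0 < (φ - HahnSeries.C a).orderTop

/-- `φ` is a Puiseux series root of `p` at the point `P = (s₁,s₂)`. A Puiseux series in
the local parameter at `s₁`, with exponents of common denominator `n`, is a Laurent series in the
`n`-th root `u` of that parameter; it satisfies `p(x,φ) = 0`, and its value at `s₁` is `s₂`. -/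
def IsBranch (p : Poly₂ K) (P : OnePoint K × OnePoint K) (n : ℕ) (φ : LaurentSeries K) : Prop :=
  0 < n ∧ MvPolynomial.aeval ![coordAt P.1 n, φ] p = 0 ∧ CenteredAt φ P.2

/-- The series `r(x,φ)`. -/
def evalBranch (r : Rat₂ K) (s : OnePoint K) (n : ℕ) (φ : LaurentSeries K) : LaurentSeries K :=
  MvPolynomial.aeval ![coordAt s n, φ] (numer r) / MvPolynomial.aeval ![coordAt s n, φ] (denom r)

/-- `P` is a pole of `r` on the curve of `p`: along some branch at `P`, `r` has negative order. -/
def IsPoleOn (p : Poly₂ K) (r : Rat₂ K) (P : curve p) : Prop :=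
  ∃ n φ, IsBranch p P n φ ∧ (evalBranch r P.1.1 n φ).orderTop < 0

/-- `P` is a root of `r` on the curve of `p`: along some branch at `P`, `r` has positive order. -/
def IsRootOn (p : Poly₂ K) (r : Rat₂ K) (P : curve p) : Prop :=
  ∃ n φ, IsBranch p P n φ ∧ 0 < (evalBranch r P.1.1 n φ).orderTop

/-- The union of the orbits of the poles and roots of `r` on the curve of `p`. -/
def specialOrbits (p : Poly₂ K) (r : Rat₂ K) : Set (curve p) :=
  {P | ∃ Q, SameOrbit p Q P ∧ (IsPoleOn p r Q ∨ IsRootOn p r Q)}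

end SeparatedVariables

end

/-! Let L be the function field of the curve, Ω an algebraic closure of L, and G the group generated
by the automorphisms of Ω over K(x) and those over K(y) (`orbitGroup`). In L, membership of (f,g) in
F(r,p) reads f(x) - g(y) = r(x,y) (`IsFunctionField.mem_F_iff`). A non-constant element of F(p)
gives a transcendental t in K(x) ∩ K(y). It is fixed by G, and Ω is algebraic over K(t), so every
element of Ω has finitely many conjugates under G (`finite_orbit`). The mean h of the conjugates of
f(x) is G-invariant, so by Galois theory it lies in K(x) ∩ K(y), that is, h = h₁(x) = h₂(y) with
(h₁,h₂) in F(p).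

Subtracting (h₁,h₂) removes all poles that do not lie under special orbits. For a place v of Ω, the
centers on C of the places v∘σ, σ in G, lie in a single orbit, because multiplying σ on the right by
a generator of G preserves the value of x or of y. If this orbit contains no pole of r, then r is
finite at all these places, since a place where r is infinite expands into a Puiseux branch along
which r has negative order (`exists_center`). Telescoping then bounds all differences σ(f(x)) - f(x)
(`val_conj_sub_le`), hence their mean f(x) - h (`exists_mean`). This gives `exists_approximation`
and the first claim. The special points found in this way are always poles of r.

For the second claim write (h₁,h₂) = (H(f₀),H(g₀)), and suppose the orbit is not special, so that f
- H(f₀) and g - H(g₀) are regular along it. If deg H > 0, then f has a pole at s₁ of order m(s₁,f₀)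
deg H, which is excluded. So deg H ≤ 0. As f₀ and g₀ have poles all along the orbit
(`SameOrbit.isPoleOf_iff`), H(f₀) and H(g₀) have none there, and neither do f and g. -/

noncomputable section
namespace SeparatedVariables

open Polynomial IntermediateField
open scoped IntermediateField.algebraAdjoinAdjoin

/-! ### Places of a field over K and the values of its elements -/

section Places

variable {K E Γ₀ : Type*} [Field K] [Field E] [Algebra K E] [LinearOrderedCommGroupWithZero Γ₀]
  {v : Valuation E Γ₀}

/-- `z` takes the value `s` at the place given by the valuation `v`. -/
def IsAt (v : Valuation E Γ₀) (z : E) (s : OnePoint K) : Prop :=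
  s.elim (1 < v z) fun a => v (z - algebraMap K E a) < 1

theorem isAt_infty {z : E} : IsAt v z (∞ : OnePoint K) ↔ 1 < v z := Iff.rfl

theorem isAt_coe {z : E} {a : K} : IsAt v z (a : OnePoint K) ↔ v (z - algebraMap K E a) < 1 :=
  Iff.rfl

theorem val_const (hv : ∀ c : K, v (algebraMap K E c) ≤ 1) {c : K} (hc : c ≠ 0) :
    v (algebraMap K E c) = 1 := by
  refine le_antisymm (hv c) ?_
  have h := hv c⁻¹
  rw [map_inv₀, map_inv₀] at h
  have h0 : 0 < v (algebraMap K E c) := by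
    rw [zero_lt_iff, Valuation.ne_zero_iff]
    simpa using hc
  exact (inv_le_one₀ h0).1 h

theorem const_eq_zero_of_val_lt_one (hv : ∀ c : K, v (algebraMap K E c) ≤ 1) {c : K}
    (h : v (algebraMap K E c) < 1) : c = 0 := by
  by_contra hc
  exact h.ne (val_const hv hc)

theorem val_aeval_le_one (hv : ∀ c : K, v (algebraMap K E c) ≤ 1) {z : E} (hz : v z ≤ 1)
    (q : K[X]) : v (aeval z q) ≤ 1 := by
  rw [aeval_eq_sum_range]
  refine v.map_sum_le fun i _ => ?_
  rw [Algebra.smul_def, map_mul, map_pow]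
  exact mul_le_one' (hv _) (pow_le_one' hz _)

theorem val_le_one_of_val_sub_lt (hv : ∀ c : K, v (algebraMap K E c) ≤ 1) {z : E} {a : K}
    (h : v (z - algebraMap K E a) < 1) : v z ≤ 1 := by
  have := v.map_add (z - algebraMap K E a) (algebraMap K E a)
  rw [sub_add_cancel] at this
  exact this.trans (max_le h.le (hv a))

theorem val_aeval_of_one_lt (hv : ∀ c : K, v (algebraMap K E c) ≤ 1) {z : E} (hz : 1 < v z)
    {q : K[X]} (hq : q ≠ 0) : v (aeval z q) = v z ^ q.natDegree := by
  rw [aeval_eq_sum_range, Finset.sum_range_succ]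
  have hlead : v (q.coeff q.natDegree • z ^ q.natDegree) = v z ^ q.natDegree := by
    rw [Algebra.smul_def, map_mul, map_pow, val_const hv (by simpa using hq), one_mul]
  rw [v.map_add_eq_of_lt_right, hlead]
  rw [hlead]
  refine v.map_sum_lt (pow_pos (zero_lt_one.trans hz) _).ne' fun i hi => ?_
  rw [Algebra.smul_def, map_mul, map_pow]
  calc _ ≤ 1 * v z ^ i := mul_le_mul_left (hv _) _
    _ < _ := by
      rw [one_mul]
      exact pow_lt_pow_right₀ hz (Finset.mem_range.1 hi)

theorem val_aeval_sub_eval (hv : ∀ c : K, v (algebraMap K E c) ≤ 1) {z : E} {a : K}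
    (hz : v (z - algebraMap K E a) < 1) (q : K[X]) :
    v (aeval z q - algebraMap K E (q.eval a)) < 1 := by
  obtain ⟨q', hq'⟩ := X_sub_C_dvd_sub_C_eval (a := a) (p := q)
  have h := congrArg (aeval z) hq'
  simp only [map_sub, map_mul, aeval_C, aeval_X] at h
  rw [h, map_mul]
  exact mul_lt_one_of_lt_of_le hz (val_aeval_le_one hv (val_le_one_of_val_sub_lt hv hz) _)

theorem val_eq_one_of_sub_const (hv : ∀ c : K, v (algebraMap K E c) ≤ 1) {z : E} {a : K}
    (ha : a ≠ 0) (hz : v (z - algebraMap K E a) < 1) : v z = 1 := by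
  have := v.map_add_eq_of_lt_right (x := z - algebraMap K E a) (y := algebraMap K E a)
    (by rwa [val_const hv ha])
  rwa [sub_add_cancel, val_const hv ha] at this

/-- Once the full power of X - a is split off, the cofactor has non-zero residue and hence value 1.
-/
theorem val_aeval_of_val_sub_lt (hv : ∀ c : K, v (algebraMap K E c) ≤ 1) {z : E} {a : K}
    (hz : v (z - algebraMap K E a) < 1) {q : K[X]} (hq : q ≠ 0) :
    v (aeval z q) = v (z - algebraMap K E a) ^ q.rootMultiplicity a := by
  obtain ⟨q', hq', hnd⟩ := exists_eq_pow_rootMultiplicity_mul_and_not_dvd q hq a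
  have h := congrArg (fun q => v (aeval z q)) hq'
  simp only [map_sub, map_mul, aeval_C, aeval_X, map_pow] at h
  rw [h]
  have h1 : q'.eval a ≠ 0 := by rwa [Ne, ← IsRoot.def, ← dvd_iff_isRoot]
  rw [val_eq_one_of_sub_const hv h1 (val_aeval_sub_eval hv hz q'), mul_one]

/-- The polynomial splits, so if every z - (root) had value at least 1, so would their product. -/
theorem exists_val_sub_lt_of_aeval [IsAlgClosed K] (hv : ∀ c : K, v (algebraMap K E c) ≤ 1) {z : E}
    {q : K[X]} (hq : q ≠ 0) (h : v (aeval z q) < 1) : ∃ a : K, v (z - algebraMap K E a) < 1 := by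
  by_contra! hcon
  rw [(IsAlgClosed.splits q).eq_prod_roots, map_mul, map_mul, aeval_C,
    val_const hv (by simpa using hq), one_mul, map_multiset_prod, map_multiset_prod,
    Multiset.map_map, Multiset.map_map] at h
  refine h.not_ge ?_
  refine Multiset.one_le_prod fun x hx => ?_
  obtain ⟨b, -, rfl⟩ := Multiset.mem_map.1 hx
  simpa using hcon b

theorem exists_relation_of_isAlgebraic {u w : E} (h : IsAlgebraic K⟮u⟯ w) :
    ∃ Q : K[X][X], Q ≠ 0 ∧ Q.eval₂ (aeval u : K[X] →ₐ[K] E).toRingHom w = 0 := by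
  have h' : IsAlgebraic (Algebra.adjoin K {u}) w :=
    (IsFractionRing.isAlgebraic_iff (Algebra.adjoin K {u}) K⟮u⟯ E).2 h
  obtain ⟨q, hq0, hq⟩ := h'
  have hmem : ∀ P : K[X], aeval u P ∈ Algebra.adjoin K {u} := fun P => aeval_mem_adjoin_singleton K u
  let f : K[X] →+* Algebra.adjoin K {u} :=
    ((aeval u : K[X] →ₐ[K] E).codRestrict (Algebra.adjoin K {u}) hmem).toRingHom
  have hf : Function.Surjective f := by
    rintro ⟨x, hx⟩
    rw [Algebra.adjoin_singleton_eq_range_aeval] at hx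
    obtain ⟨P, hP⟩ := hx
    exact ⟨P, Subtype.ext hP⟩
  obtain ⟨Q, rfl⟩ := Polynomial.map_surjective f hf q
  refine ⟨Q, fun h0 => hq0 (by simp [h0]), ?_⟩
  rw [aeval_def, eval₂_map] at hq
  exact hq

/-- The residue field is K. Take a polynomial relation between u and w, read it as a polynomial in u
over K[w], and cancel the largest power of u. What remains reduces modulo u to a non-zero polynomial
over K that kills the residue of w. -/
theorem exists_val_sub_lt_of_isAlgebraic [IsAlgClosed K] (hv : ∀ c : K, v (algebraMap K E c) ≤ 1)
    {u w : E} (hu0 : u ≠ 0) (hu : v u < 1) (hw : v w ≤ 1) (h : IsAlgebraic K⟮u⟯ w) :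
    ∃ a : K, v (w - algebraMap K E a) < 1 := by
  obtain ⟨Q, hQ0, hQ⟩ := exists_relation_of_isAlgebraic h
  obtain ⟨R, hR⟩ : ∃ R : K[X][X], R = Bivariate.swap Q := ⟨_, rfl⟩
  have hR0 : R ≠ 0 := by rw [hR]; simpa using hQ0
  have key : ∀ P : K[X][X], (Bivariate.swap P).eval₂ (aeval w : K[X] →ₐ[K] E).toRingHom u =
      P.eval₂ (aeval u : K[X] →ₐ[K] E).toRingHom w := by
    intro P
    induction P using Polynomial.induction_on' with
    | add p q hp hq => rw [map_add, eval₂_add, eval₂_add, hp, hq]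
    | monomial n a =>
      induction a using Polynomial.induction_on' with
      | add p q hp hq => rw [map_add, map_add, eval₂_add, eval₂_add, hp, hq]
      | monomial m c =>
        rw [Bivariate.swap_monomial_monomial]
        simp [eval₂_monomial, aeval_monomial]
        ring
  have hR1 : R.eval₂ (aeval w : K[X] →ₐ[K] E).toRingHom u = 0 := by rw [hR, key, hQ]
  obtain ⟨S, hS, hnd⟩ := exists_eq_pow_rootMultiplicity_mul_and_not_dvd R hR0 0
  rw [hS] at hR1
  simp only [map_zero, sub_zero, eval₂_mul, eval₂_pow, eval₂_X] at hR1
  have hS1 := (mul_eq_zero.1 hR1).resolve_left (pow_ne_zero _ hu0)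
  rw [map_zero, sub_zero, X_dvd_iff] at hnd
  refine exists_val_sub_lt_of_aeval hv hnd ?_
  have h2 := congrArg (eval₂ (aeval w : K[X] →ₐ[K] E).toRingHom u) (divX_mul_X_add S)
  rw [hS1, eval₂_add, eval₂_mul, eval₂_X, eval₂_C] at h2
  have h3 : aeval w (S.coeff 0) = -(eval₂ (aeval w : K[X] →ₐ[K] E).toRingHom u S.divX * u) := by
    rw [eq_neg_iff_add_eq_zero, add_comm]
    exact h2
  rw [h3, Valuation.map_neg, map_mul]
  refine mul_lt_one_of_nonneg_of_lt_one_right ?_ zero_le hu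
  rw [eval₂_eq_sum_range]
  refine v.map_sum_le fun i _ => ?_
  rw [map_mul, map_pow]
  exact mul_le_one' (val_aeval_le_one hv hw _) (pow_le_one' hu.le _)

theorem adjoin_inv (z : E) : K⟮z⁻¹⟯ = K⟮z⟯ := by
  apply le_antisymm <;> rw [adjoin_simple_le_iff]
  · exact inv_mem (mem_adjoin_simple_self K z)
  · simpa using inv_mem (mem_adjoin_simple_self K z⁻¹)

theorem adjoin_sub_algebraMap (z : E) (a : K) : K⟮z - algebraMap K E a⟯ = K⟮z⟯ := by
  apply le_antisymm <;> rw [adjoin_simple_le_iff]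
  · exact sub_mem (mem_adjoin_simple_self K z) (IntermediateField.algebraMap_mem _ a)
  · simpa using add_mem (mem_adjoin_simple_self K (z - algebraMap K E a)) (IntermediateField.algebraMap_mem _ a)

/-- The local parameter at the value `s` of `z`. -/
def localParam (z : E) (s : OnePoint K) : E :=
  s.elim z⁻¹ fun a => z - algebraMap K E a

theorem adjoin_localParam (z : E) (s : OnePoint K) : K⟮localParam z s⟯ = K⟮z⟯ := by
  induction s using OnePoint.rec with
  | infty => exact adjoin_inv z
  | coe a => exact adjoin_sub_algebraMap z a

theorem IsAt.val_localParam_lt {z : E} {s : OnePoint K} (h : IsAt v z s) :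
    v (localParam z s) < 1 := by
  induction s using OnePoint.rec with
  | infty =>
    change v z⁻¹ < 1
    rw [map_inv₀]
    exact inv_lt_one_of_one_lt₀ h
  | coe a => exact h

theorem transcendental_ne_zero {z : E} (hz : Transcendental K z) : z ≠ 0 := by
  rintro rfl
  exact hz isAlgebraic_zero

theorem localParam_ne_zero {z : E} (hz : Transcendental K z) (s : OnePoint K) :
    localParam z s ≠ 0 := by
  induction s using OnePoint.rec with
  | infty => exact inv_ne_zero (transcendental_ne_zero hz)
  | coe a =>
    intro h
    refine hz ?_
    rw [sub_eq_zero.1 h]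
    exact isAlgebraic_algebraMap a

theorem IsAt.exists_isAt [IsAlgClosed K] (hv : ∀ c : K, v (algebraMap K E c) ≤ 1) {z : E}
    {s : OnePoint K} (h : IsAt v z s) (hz : Transcendental K z) {w : E}
    (hw : IsAlgebraic K⟮z⟯ w) : ∃ s' : OnePoint K, IsAt v w s' := by
  rcases lt_or_ge 1 (v w) with h1 | h1
  · exact ⟨∞, h1⟩
  · rw [← adjoin_localParam z s] at hw
    obtain ⟨a, ha⟩ := exists_val_sub_lt_of_isAlgebraic hv (localParam_ne_zero hz s)
      h.val_localParam_lt h1 hw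
    exact ⟨(a : OnePoint K), ha⟩

/-- The embedding of the univariate rational functions given by a transcendental element. -/
def ratEval (z : E) (hz : Transcendental K z) : RatFunc K →ₐ[K] E :=
  RatFunc.liftAlgHom (aeval z) (nonZeroDivisors_le_comap_nonZeroDivisors_of_injective _
    (transcendental_iff_injective.1 hz))

theorem ratEval_apply (z : E) (hz : Transcendental K z) (f : RatFunc K) :
    ratEval z hz f = aeval z f.num / aeval z f.denom :=
  RatFunc.liftAlgHom_apply _ _ _

/-- The base w is the inverse of the value of the local parameter. One w serves all f, which turns
comparisons of values into comparisons of multiplicities. -/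
theorem IsAt.val_ratEval (hv : ∀ c : K, v (algebraMap K E c) ≤ 1) {z : E} (hz : Transcendental K z)
    {s : OnePoint K} (h : IsAt v z s) :
    ∃ w : Γ₀, 1 < w ∧ ∀ f : RatFunc K, f ≠ 0 → v (ratEval z hz f) = w ^ mult s f := by
  induction s using OnePoint.rec with
  | infty =>
    refine ⟨v z, h, fun f hf => ?_⟩
    rw [ratEval_apply, map_div₀, val_aeval_of_one_lt hv h (by simpa using hf),
      val_aeval_of_one_lt hv h f.denom_ne_zero]
    change _ = v z ^ f.intDegree
    rw [RatFunc.intDegree, zpow_sub₀ (zero_lt_one.trans h).ne', zpow_natCast, zpow_natCast]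
  | coe a =>
    have h0 : 0 < v (z - algebraMap K E a) := by
      rw [zero_lt_iff, Valuation.ne_zero_iff]
      exact localParam_ne_zero hz (a : OnePoint K)
    refine ⟨(v (z - algebraMap K E a))⁻¹, (one_lt_inv₀ h0).2 h, fun f hf => ?_⟩
    rw [ratEval_apply, map_div₀, val_aeval_of_val_sub_lt hv h (by simpa using hf),
      val_aeval_of_val_sub_lt hv h f.denom_ne_zero]
    change _ = _ ^ ((f.denom.rootMultiplicity a : ℤ) - f.num.rootMultiplicity a)
    rw [zpow_sub₀ (inv_ne_zero h0.ne'), zpow_natCast, zpow_natCast, inv_pow, inv_pow]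
    field_simp

theorem IsAt.one_lt_val_ratEval_iff (hv : ∀ c : K, v (algebraMap K E c) ≤ 1) {z : E}
    (hz : Transcendental K z) {s : OnePoint K} (h : IsAt v z s) (f : RatFunc K) :
    1 < v (ratEval z hz f) ↔ IsPoleOf s f := by
  rcases eq_or_ne f 0 with rfl | hf
  · have : mult s (0 : RatFunc K) = 0 := by
      induction s using OnePoint.rec with
      | infty => exact RatFunc.intDegree_zero
      | coe a => simp [mult]
    simp [IsPoleOf, this]
  · obtain ⟨w, hw, H⟩ := h.val_ratEval hv hz
    rw [H f hf, one_lt_zpow_iff_right₀ hw, IsPoleOf]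

theorem exists_valuationSubring_isAt {z : E} (hz : Transcendental K z) (s : OnePoint K) :
    ∃ A : ValuationSubring E, (∀ c : K, A.valuation (algebraMap K E c) ≤ 1) ∧
      IsAt A.valuation z s := by
  have main : ∀ u : E, Transcendental K u → ∃ A : ValuationSubring E,
      (∀ c : K, A.valuation (algebraMap K E c) ≤ 1) ∧ A.valuation u < 1 := by
    intro u hu
    let B := (Algebra.adjoin K {u})
    have huB : u ∈ B := Algebra.self_mem_adjoin_singleton K u
    -- A proper ideal of a subring is contained in the non-units of some valuation ring above it.
    -- The ideal (u) of K[u] is proper because u P(u) = 1 would make u algebraic.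
    have hI : (Ideal.span {(⟨u, huB⟩ : B.toSubring)}) ≠ ⊤ := by
      rw [Ne, Ideal.span_singleton_eq_top]
      rintro hunit
      obtain ⟨⟨b, hb⟩, hub⟩ := isUnit_iff_exists_inv.1 hunit
      have hub' : u * b = 1 := congrArg Subtype.val hub
      change b ∈ Algebra.adjoin K {u} at hb
      rw [Algebra.adjoin_singleton_eq_range_aeval] at hb
      obtain ⟨P, rfl⟩ := hb
      refine hu ⟨X * P - 1, fun h0 => ?_, ?_⟩
      · have := congrArg (eval 0) h0
        simp at this
      · simp only [map_sub, map_mul, aeval_X, map_one]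
        rw [sub_eq_zero]
        exact hub'
    obtain ⟨A, hA1, hA2⟩ := Ideal.image_subset_nonunits_valuationSubring _ hI
    refine ⟨A, fun c => ?_, ?_⟩
    · rw [A.valuation_le_one_iff]
      exact hA1 (algebraMap_mem B c)
    · have : u ∈ A.nonunits := hA2 ⟨⟨u, huB⟩, Ideal.mem_span_singleton_self _, rfl⟩
      exact this
  induction s using OnePoint.rec with
  | infty =>
    obtain ⟨A, h1, h2⟩ := main z⁻¹ (by simpa [Transcendental, IsAlgebraic.inv_iff] using hz)
    refine ⟨A, h1, ?_⟩
    rw [isAt_infty]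
    rw [map_inv₀] at h2
    exact (inv_lt_one₀ (by rw [zero_lt_iff, Valuation.ne_zero_iff]; exact (transcendental_ne_zero hz))).1 h2
  | coe a =>
    exact main (z - algebraMap K E a) fun h => hz (by
      simpa using h.add (isAlgebraic_algebraMap a))

end Places

/-! ### Bi-homogenization, and the poles of f and g at the points of the curve -/

section Homogenization

variable {K : Type*} [Field K]

/-- The bi-homogenization, of bi-degree `(N₀, N₁)`, of a bivariate polynomial. -/
def biHomogenize (N₀ N₁ : ℕ) (F : Poly₂ K) : MvPolynomial (Fin 4) K :=
  ∑ m ∈ F.support, MvPolynomial.C (F.coeff m) *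
    (MvPolynomial.X 0 ^ (N₀ - m 0) * MvPolynomial.X 1 ^ m 0) *
    (MvPolynomial.X 2 ^ (N₁ - m 1) * MvPolynomial.X 3 ^ m 1)

/-- The homogenization, of degree `N`, of a univariate polynomial, evaluated at `(X₀, X₁)`. -/
def homEval {R : Type*} [CommRing R] [Algebra K R] (N : ℕ) (A : K[X]) (X₀ X₁ : R) : R :=
  ∑ i ∈ Finset.range (N + 1), algebraMap K R (A.coeff i) * (X₀ ^ (N - i) * X₁ ^ i)

/-- Homogeneous coordinates of a pair of points of the projective line. -/
def homCoord (P : OnePoint K × OnePoint K) : Fin 4 → K :=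
  ![hom₀ P.1, hom₁ P.1, hom₀ P.2, hom₁ P.2]

theorem mem_curve_iff {p : Poly₂ K} {P : OnePoint K × OnePoint K} :
    P ∈ curve p ↔
      MvPolynomial.aeval (homCoord P) (biHomogenize (p.degreeOf 0) (p.degreeOf 1) p) = 0 := by
  simp [curve, biHomogenize, homCoord]

theorem aeval_biHomogenize {R : Type*} [CommRing R] [Algebra K R] {N₀ N₁ : ℕ} {F : Poly₂ K}
    (h₀ : F.degreeOf 0 ≤ N₀) (h₁ : F.degreeOf 1 ≤ N₁) (X₀ Y₀ z w : R) :
    MvPolynomial.aeval ![X₀, X₀ * z, Y₀, Y₀ * w] (biHomogenize N₀ N₁ F) =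
      X₀ ^ N₀ * Y₀ ^ N₁ * MvPolynomial.aeval ![z, w] F := by
  rw [biHomogenize, map_sum, MvPolynomial.aeval_def, MvPolynomial.eval₂_eq', Finset.mul_sum]
  refine Finset.sum_congr rfl fun m hm => ?_
  have e₀ : X₀ ^ N₀ = X₀ ^ (N₀ - m 0) * X₀ ^ m 0 := by
    rw [← pow_add, Nat.sub_add_cancel ((MvPolynomial.monomial_le_degreeOf 0 hm).trans h₀)]
  have e₁ : Y₀ ^ N₁ = Y₀ ^ (N₁ - m 1) * Y₀ ^ m 1 := by
    rw [← pow_add, Nat.sub_add_cancel ((MvPolynomial.monomial_le_degreeOf 1 hm).trans h₁)]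
  rw [e₀, e₁]
  simp only [Fin.isValue, Nat.succ_eq_add_one, Nat.reduceAdd, map_mul, MvPolynomial.aeval_C, map_pow,
    MvPolynomial.aeval_X, Matrix.cons_val_zero, Matrix.cons_val_one, Matrix.cons_val,
    Fin.prod_univ_two, mul_pow]
  ring

theorem homEval_mul {R : Type*} [CommRing R] [Algebra K R] {N : ℕ} {A : K[X]}
    (h : A.natDegree ≤ N) (X₀ z : R) :
    homEval N A X₀ (X₀ * z) = X₀ ^ N * aeval z A := by
  rw [homEval, aeval_eq_sum_range' (Nat.lt_succ_of_le h), Finset.mul_sum]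
  refine Finset.sum_congr rfl fun i hi => ?_
  have e : X₀ ^ N = X₀ ^ (N - i) * X₀ ^ i := by
    rw [← pow_add, Nat.sub_add_cancel (Nat.lt_succ_iff.1 (Finset.mem_range.1 hi))]
  rw [e, Algebra.smul_def]
  ring

theorem map_homEval {R S : Type*} [CommRing R] [Algebra K R] [CommRing S] [Algebra K S]
    (φ : R →ₐ[K] S) (N : ℕ) (A : K[X]) (X₀ X₁ : R) :
    φ (homEval N A X₀ X₁) = homEval N A (φ X₀) (φ X₁) := by
  simp [homEval]

/-- The fraction field of the polynomial ring in four homogeneous coordinates. -/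
abbrev HomField (K : Type*) [Field K] : Type _ := FractionRing (MvPolynomial (Fin 4) K)

/-- The homogeneous coordinates as elements of the fraction field. -/
def homVar (K : Type*) [Field K] (i : Fin 4) : HomField K :=
  algebraMap (MvPolynomial (Fin 4) K) (HomField K) (MvPolynomial.X i)

theorem homVar_ne_zero (i : Fin 4) : homVar K i ≠ 0 := by
  simp [homVar]

/-- Puts the generic coordinates into the shape `X₀, X₀ * z` required by `aeval_biHomogenize`, so
that identities between forms can be checked after dehomogenizing. -/
theorem homVar_eq : homVar K = ![homVar K 0, homVar K 0 * (homVar K 1 / homVar K 0), homVar K 2,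
    homVar K 2 * (homVar K 3 / homVar K 2)] := by
  have h0 := homVar_ne_zero (K := K) 0
  have h2 := homVar_ne_zero (K := K) 2
  ext i
  fin_cases i <;> simp <;> field_simp

theorem algebraMap_eq_aeval_homVar (H : MvPolynomial (Fin 4) K) :
    algebraMap _ (HomField K) H = MvPolynomial.aeval (homVar K) H := by
  have : (IsScalarTower.toAlgHom K (MvPolynomial (Fin 4) K) (HomField K)) =
      MvPolynomial.aeval (homVar K) := by
    apply MvPolynomial.algHom_ext
    intro i
    simp [homVar]
  exact DFunLike.congr_fun this H

theorem algebraMap_biHomogenize {N₀ N₁ : ℕ} {F : Poly₂ K}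
    (h₀ : F.degreeOf 0 ≤ N₀) (h₁ : F.degreeOf 1 ≤ N₁) :
    algebraMap _ (HomField K) (biHomogenize N₀ N₁ F) = homVar K 0 ^ N₀ * homVar K 2 ^ N₁ *
      MvPolynomial.aeval ![homVar K 1 / homVar K 0, homVar K 3 / homVar K 2] F := by
  rw [algebraMap_eq_aeval_homVar, ← aeval_biHomogenize h₀ h₁, ← homVar_eq]

theorem biHomogenize_mul {F G : Poly₂ K} (hF : F ≠ 0) (hG : G ≠ 0) {N₀ N₁ : ℕ}
    (h₀ : (F * G).degreeOf 0 ≤ N₀) (h₁ : (F * G).degreeOf 1 ≤ N₁) :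
    biHomogenize N₀ N₁ (F * G) = biHomogenize (F.degreeOf 0) (F.degreeOf 1) F *
      biHomogenize (N₀ - F.degreeOf 0) (N₁ - F.degreeOf 1) G := by
  have d₀ := MvPolynomial.degreeOf_mul_eq (n := 0) hF hG
  have d₁ := MvPolynomial.degreeOf_mul_eq (n := 1) hF hG
  apply IsFractionRing.injective (MvPolynomial (Fin 4) K) (HomField K)
  rw [map_mul, algebraMap_biHomogenize h₀ h₁, algebraMap_biHomogenize le_rfl le_rfl,
    algebraMap_biHomogenize (by omega) (by omega), map_mul]
  have e₀ : homVar K 0 ^ N₀ = homVar K 0 ^ F.degreeOf 0 * homVar K 0 ^ (N₀ - F.degreeOf 0) := by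
    rw [← pow_add]; congr 1; omega
  have e₁ : homVar K 2 ^ N₁ = homVar K 2 ^ F.degreeOf 1 * homVar K 2 ^ (N₁ - F.degreeOf 1) := by
    rw [← pow_add]; congr 1; omega
  rw [e₀, e₁]
  ring

/-- The form of a multiple of p is a multiple of the form of p, so it also vanishes at the points at
infinity, even when taken in a larger bi-degree. -/
theorem aeval_biHomogenize_eq_zero_of_dvd {p F : Poly₂ K} (hp : p ≠ 0) (hpF : p ∣ F) {N₀ N₁ : ℕ}
    (h₀ : F.degreeOf 0 ≤ N₀) (h₁ : F.degreeOf 1 ≤ N₁) {P : OnePoint K × OnePoint K}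
    (hP : P ∈ curve p) : MvPolynomial.aeval (homCoord P) (biHomogenize N₀ N₁ F) = 0 := by
  obtain ⟨G, rfl⟩ := hpF
  rcases eq_or_ne G 0 with rfl | hG
  · simp [biHomogenize]
  · rw [biHomogenize_mul hp hG h₀ h₁, map_mul, mem_curve_iff.1 hP, zero_mul]

/-- Substituting one of the two variables into a univariate polynomial. -/
def polyVar (i : Fin 2) : K[X] →ₐ[K] Poly₂ K := aeval (MvPolynomial.X i)

theorem degreeOf_polyVar_le (i j : Fin 2) (A : K[X]) :
    (polyVar i A).degreeOf j ≤ if i = j then A.natDegree else 0 := by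
  rw [polyVar, aeval_eq_sum_range]
  refine (MvPolynomial.degreeOf_sum_le _ _ _).trans (Finset.sup_le fun k hk => ?_)
  rw [MvPolynomial.smul_eq_C_mul]
  refine (MvPolynomial.degreeOf_C_mul_le _ _ _).trans ?_
  refine (MvPolynomial.degreeOf_pow_le _ _ _).trans ?_
  rw [MvPolynomial.degreeOf_X]
  have := Finset.mem_range.1 hk
  rcases eq_or_ne i j with rfl | h
  · simp; omega
  · simp [h, h.symm]

/-- The numerator of `f(x) - g(y)`. -/
def separatedNumer (f g : RatFunc K) : Poly₂ K :=
  polyVar 0 f.num * polyVar 1 g.denom - polyVar 1 g.num * polyVar 0 f.denom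

/-- The degree of the rational function `f` as a map of the projective line. -/
def mapDegree (f : RatFunc K) : ℕ := max f.num.natDegree f.denom.natDegree

theorem natDegree_num_le (f : RatFunc K) : f.num.natDegree ≤ mapDegree f := le_max_left _ _

theorem natDegree_denom_le (f : RatFunc K) : f.denom.natDegree ≤ mapDegree f := le_max_right _ _

theorem degreeOf_separatedNumer_le (f g : RatFunc K) :
    (separatedNumer f g).degreeOf 0 ≤ mapDegree f ∧
      (separatedNumer f g).degreeOf 1 ≤ mapDegree g := by
  have h (i j : Fin 2) (A : K[X]) := degreeOf_polyVar_le i j A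
  have a1 := h 0 0 f.num
  have a2 := h 0 1 f.num
  have a3 := h 1 0 g.num
  have a4 := h 1 1 g.num
  have b1 := h 0 0 f.denom
  have b2 := h 0 1 f.denom
  have b3 := h 1 0 g.denom
  have b4 := h 1 1 g.denom
  simp only [if_true, Fin.isValue, zero_ne_one, one_ne_zero, if_false] at *
  constructor
  · refine (MvPolynomial.degreeOf_sub_le _ _ _).trans (max_le ?_ ?_) <;>
    refine (MvPolynomial.degreeOf_mul_le _ _ _).trans ?_ <;> rw [mapDegree] <;> omega
  · refine (MvPolynomial.degreeOf_sub_le _ _ _).trans (max_le ?_ ?_) <;>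
    refine (MvPolynomial.degreeOf_mul_le _ _ _).trans ?_ <;> rw [mapDegree] <;> omega

theorem aeval_polyVar {R : Type*} [CommRing R] [Algebra K R] (z : Fin 2 → R) (i : Fin 2)
    (A : K[X]) : MvPolynomial.aeval z (polyVar i A) = aeval (z i) A := by
  rw [polyVar, ← aeval_algHom_apply, MvPolynomial.aeval_X]

theorem biHomogenize_separatedNumer (f g : RatFunc K) :
    biHomogenize (mapDegree f) (mapDegree g) (separatedNumer f g) =
      homEval (mapDegree f) f.num (MvPolynomial.X 0) (MvPolynomial.X 1) *
        homEval (mapDegree g) g.denom (MvPolynomial.X 2) (MvPolynomial.X 3) -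
      homEval (mapDegree g) g.num (MvPolynomial.X 2) (MvPolynomial.X 3) *
        homEval (mapDegree f) f.denom (MvPolynomial.X 0) (MvPolynomial.X 1) := by
  apply IsFractionRing.injective (MvPolynomial (Fin 4) K) (HomField K)
  obtain ⟨h₀, h₁⟩ := degreeOf_separatedNumer_le f g
  have key : ∀ (i j : Fin 4) (N : ℕ) (A : K[X]) (_ : A.natDegree ≤ N),
      algebraMap (MvPolynomial (Fin 4) K) (HomField K)
        (homEval N A (MvPolynomial.X i) (MvPolynomial.X j)) =
        homVar K i ^ N * aeval (homVar K j / homVar K i) A := by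
    intro i j N A hA
    rw [← homEval_mul hA, mul_div_cancel₀ _ (homVar_ne_zero i)]
    exact map_homEval (IsScalarTower.toAlgHom K (MvPolynomial (Fin 4) K) (HomField K)) _ _ _ _
  rw [algebraMap_biHomogenize h₀ h₁, map_sub, map_mul, map_mul, key _ _ _ _ (natDegree_num_le _),
    key _ _ _ _ (natDegree_denom_le _), key _ _ _ _ (natDegree_num_le _), key _ _ _ _ (natDegree_denom_le _),
    separatedNumer, map_sub, map_mul, map_mul]
  simp only [aeval_polyVar]
  simp only [Fin.isValue, Matrix.cons_val_zero, Matrix.cons_val_one, Matrix.cons_val_fin_one]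
  ring

theorem homEval_coe {N : ℕ} {A : K[X]} (h : A.natDegree ≤ N) (a : K) :
    homEval N A (hom₀ (a : OnePoint K)) (hom₁ (a : OnePoint K)) = A.eval a := by
  have := homEval_mul (R := K) h 1 a
  rw [one_mul, one_pow, one_mul, coe_aeval_eq_eval] at this
  exact this

theorem homEval_infty (N : ℕ) (A : K[X]) :
    homEval N A (hom₀ (∞ : OnePoint K)) (hom₁ (∞ : OnePoint K)) = A.coeff N := by
  change homEval N A (0 : K) 1 = _
  rw [homEval, Finset.sum_range_succ, Finset.sum_eq_zero]
  · simp
  · intro i hi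
    have : N - i ≠ 0 := by have := Finset.mem_range.1 hi; omega
    simp [this]

/-- At a finite point coprimality keeps the numerator from vanishing together with the denominator.
At infinity the form takes the coefficient in degree `mapDegree f`, which vanishes for the
denominator exactly when the numerator has larger degree. -/
theorem homEval_denom_eq_zero_iff (f : RatFunc K) (s : OnePoint K) :
    homEval (mapDegree f) f.denom (hom₀ s) (hom₁ s) = 0 ↔ IsPoleOf s f := by
  induction s using OnePoint.rec with
  | infty =>
    rw [homEval_infty]
    change _ ↔ 0 < f.intDegree
    rw [RatFunc.intDegree, sub_pos, Nat.cast_lt, mapDegree]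
    constructor
    · intro h
      by_contra! hle
      rw [max_eq_right hle] at h
      exact f.denom_ne_zero (leadingCoeff_eq_zero.1 h)
    · intro h
      rw [max_eq_left h.le]
      exact coeff_eq_zero_of_natDegree_lt h
  | coe a =>
    rw [homEval_coe (natDegree_denom_le f)]
    change _ ↔ 0 < ((f.denom.rootMultiplicity a : ℤ) - f.num.rootMultiplicity a)
    rw [sub_pos, Nat.cast_lt]
    constructor
    · intro h
      have hn : f.num.rootMultiplicity a = 0 := by
        apply rootMultiplicity_eq_zero
        intro hr
        obtain ⟨u, w, huw⟩ := f.isCoprime_num_denom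
        have := congrArg (eval a) huw
        rw [eval_add, eval_mul, eval_mul, h, hr.eq_zero] at this
        simp at this
      rw [hn]
      exact (rootMultiplicity_pos f.denom_ne_zero).2 h
    · intro h
      exact (rootMultiplicity_pos f.denom_ne_zero).1 (by omega)

theorem homEval_num_ne_zero (f : RatFunc K) {s : OnePoint K} (hs : IsPoleOf s f) :
    homEval (mapDegree f) f.num (hom₀ s) (hom₁ s) ≠ 0 := by
  have h0 := (homEval_denom_eq_zero_iff f s).2 hs
  induction s using OnePoint.rec with
  | infty =>
    rw [homEval_infty]
    change 0 < f.intDegree at hs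
    rw [RatFunc.intDegree, sub_pos, Nat.cast_lt] at hs
    rw [mapDegree, max_eq_left hs.le]
    intro h
    rw [leadingCoeff_eq_zero.1 h] at hs
    simp at hs
  | coe a =>
    rw [homEval_coe (natDegree_denom_le f)] at h0
    rw [homEval_coe (natDegree_num_le f)]
    intro h
    obtain ⟨u, w, huw⟩ := f.isCoprime_num_denom
    have := congrArg (eval a) huw
    rw [eval_add, eval_mul, eval_mul, h, h0] at this
    simp at this

/-- The form of num f · den g - num g · den f vanishes at P. Where den f vanishes num f does not, so
den g must vanish, and symmetrically. -/
theorem isPoleOf_fst_iff_snd {p : Poly₂ K} (hp : p ≠ 0) {f g : RatFunc K}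
    (hpF : p ∣ separatedNumer f g) {P : OnePoint K × OnePoint K} (hP : P ∈ curve p) :
    IsPoleOf P.1 f ↔ IsPoleOf P.2 g := by
  obtain ⟨h₀, h₁⟩ := degreeOf_separatedNumer_le f g
  have h := aeval_biHomogenize_eq_zero_of_dvd hp hpF h₀ h₁ hP
  rw [biHomogenize_separatedNumer, map_sub, map_mul, map_mul, map_homEval, map_homEval, map_homEval,
    map_homEval] at h
  simp only [MvPolynomial.aeval_X, homCoord, Fin.isValue, Matrix.cons_val_zero, Matrix.cons_val_one,
    Matrix.cons_val] at h
  constructor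
  · intro hf
    have hn := homEval_num_ne_zero f hf
    rw [← homEval_denom_eq_zero_iff] at hf ⊢
    rw [hf, mul_zero, sub_zero] at h
    exact (mul_eq_zero.1 h).resolve_left hn
  · intro hg
    have hn := homEval_num_ne_zero g hg
    rw [← homEval_denom_eq_zero_iff] at hg ⊢
    rw [hg, mul_zero, zero_sub, neg_eq_zero] at h
    exact (mul_eq_zero.1 h).resolve_left hn

end Homogenization

/-! ### The center of a place lies on the curve -/

section Centers

variable {K E Γ₀ : Type*} [Field K] [Field E] [Algebra K E] [LinearOrderedCommGroupWithZero Γ₀]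
  {v : Valuation E Γ₀}

theorem val_mvAeval_sub_lt (hv : ∀ c : K, v (algebraMap K E c) ≤ 1) {ι : Type*} {Z : ι → E}
    {c : ι → K} (hZ : ∀ i, v (Z i - algebraMap K E (c i)) < 1) (H : MvPolynomial ι K) :
    v (MvPolynomial.aeval Z H - algebraMap K E (MvPolynomial.aeval c H)) < 1 := by
  induction H using MvPolynomial.induction_on with
  | C a => simp
  | add P Q hP hQ =>
    rw [map_add, map_add, map_add, add_sub_add_comm]
    exact v.map_add_lt hP hQ
  | mul_X P i hP =>
    rw [map_mul, map_mul, map_mul, MvPolynomial.aeval_X, MvPolynomial.aeval_X]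
    have e : MvPolynomial.aeval Z P * Z i -
        algebraMap K E (MvPolynomial.aeval c P) * algebraMap K E (c i) =
      (MvPolynomial.aeval Z P - algebraMap K E (MvPolynomial.aeval c P)) * Z i +
        algebraMap K E (MvPolynomial.aeval c P) * (Z i - algebraMap K E (c i)) := by ring
    rw [e]
    refine v.map_add_lt ?_ ?_
    · rw [map_mul]
      exact mul_lt_one_of_lt_of_le hP (val_le_one_of_val_sub_lt hv (hZ i))
    · rw [map_mul]
      exact mul_lt_one_of_nonneg_of_lt_one_right (hv _) zero_le (hZ i)

/-- Homogeneous coordinates of z scaled to be integral at the place: [1 : z] at a finite value and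
[z⁻¹ : 1] at infinity. Their residues are the coordinates of s. -/
theorem IsAt.exists_homCoord {z : E} {s : OnePoint K} (h : IsAt v z s) :
    ∃ X₀ : E, v (X₀ - algebraMap K E (hom₀ s)) < 1 ∧
      v (X₀ * z - algebraMap K E (hom₁ s)) < 1 := by
  induction s using OnePoint.rec with
  | infty =>
    have hz : z ≠ 0 := by
      rintro rfl
      simp [isAt_infty] at h
    refine ⟨z⁻¹, ?_, ?_⟩
    · simpa [hom₀, localParam] using h.val_localParam_lt
    · simp [hom₁, hz]
  | coe a => exact ⟨1, by simp [hom₀], by simpa [hom₁] using isAt_coe.1 h⟩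

theorem mem_curve_of_isAt (hv : ∀ c : K, v (algebraMap K E c) ≤ 1) {p : Poly₂ K} {z w : E}
    (hzw : MvPolynomial.aeval ![z, w] p = 0) {s t : OnePoint K} (hs : IsAt v z s)
    (ht : IsAt v w t) : (s, t) ∈ curve p := by
  obtain ⟨X₀, h1, h2⟩ := hs.exists_homCoord
  obtain ⟨Y₀, h3, h4⟩ := ht.exists_homCoord
  rw [mem_curve_iff]
  have hZ : ∀ i, v ((![X₀, X₀ * z, Y₀, Y₀ * w] : Fin 4 → E) i -
      algebraMap K E (homCoord (s, t) i)) < 1 := by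
    intro i
    fin_cases i
    exacts [h1, h2, h3, h4]
  have := val_mvAeval_sub_lt hv hZ (biHomogenize (p.degreeOf 0) (p.degreeOf 1) p)
  rw [aeval_biHomogenize le_rfl le_rfl, hzw, mul_zero, zero_sub, Valuation.map_neg] at this
  exact const_eq_zero_of_val_lt_one hv this

end Centers

/-! ### Laurent series expansions at discrete places -/

section Expansion

variable {K : Type*} [Field K]

/-- If every element of `A` is `κ c + u * d` for unique `c` and `d`, then the iteration of this
decomposition expands the elements of `A` into power series in `u`. -/
theorem exists_expansion {A : Type*} [CommRing A] (κ : K →+* A) (u : A) (c : A → K) (d : A → A)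
    (hcd : ∀ a, a = κ (c a) + u * d a)
    (huniq : ∀ a k b, a = κ k + u * b → k = c a ∧ b = d a) :
    ∃ ψ : A →+* PowerSeries K, (∀ k, ψ (κ k) = PowerSeries.C k) ∧ ψ u = PowerSeries.X := by
  have c_add (a b : A) : c (a + b) = c a + c b ∧ d (a + b) = d a + d b := by
    have := huniq (a + b) (c a + c b) (d a + d b) (by
      conv_lhs => rw [hcd a, hcd b]
      rw [map_add]; ring)
    exact ⟨this.1.symm, this.2.symm⟩
  have c_smul (k : K) (b : A) : c (κ k * b) = k * c b ∧ d (κ k * b) = κ k * d b := by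
    have := huniq (κ k * b) (k * c b) (κ k * d b) (by
      conv_lhs => rw [hcd b]
      rw [map_mul]; ring)
    exact ⟨this.1.symm, this.2.symm⟩
  -- The twisted Leibniz rule for d is what makes the expansion multiplicative, by induction on the
  -- index of the coefficient.
  have c_mul (a b : A) : c (a * b) = c a * c b ∧ d (a * b) = κ (c a) * d b + d a * b := by
    have := huniq (a * b) (c a * c b) (κ (c a) * d b + d a * b) (by
      rw [map_mul, mul_add]
      have hb := hcd b
      have ha := hcd a
      linear_combination b * ha + κ (c a) * hb)
    exact ⟨this.1.symm, this.2.symm⟩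
  have c_const (k : K) : c (κ k) = k ∧ d (κ k) = 0 := by
    have := huniq (κ k) k 0 (by simp)
    exact ⟨this.1.symm, this.2.symm⟩
  have c_u : c u = 0 ∧ d u = 1 := by
    have := huniq u 0 1 (by simp)
    exact ⟨this.1.symm, this.2.symm⟩
  let e : A → PowerSeries K := fun a => PowerSeries.mk fun n => c (d^[n] a)
  have e_zero (a : A) : PowerSeries.coeff 0 (e a) = c a := by
    simp only [e, PowerSeries.coeff_mk, Function.iterate_zero, id]
  have e_succ (n : ℕ) (a : A) :
      PowerSeries.coeff (n + 1) (e a) = PowerSeries.coeff n (e (d a)) := by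
    simp only [e, PowerSeries.coeff_mk, Function.iterate_succ, Function.comp]
  have e_eq (a : A) : e a = PowerSeries.C (c a) + PowerSeries.X * e (d a) := by
    ext n
    cases n with
    | zero => simp [e_zero]
    | succ n => simp [e_succ, PowerSeries.coeff_succ_X_mul, PowerSeries.coeff_succ_C]
  have e_add (a b : A) : e (a + b) = e a + e b := by
    ext n
    induction n generalizing a b with
    | zero => rw [map_add, e_zero, e_zero, e_zero, (c_add a b).1]
    | succ n ih =>
      rw [map_add, e_succ, e_succ, e_succ, (c_add a b).2, ih, map_add]
  have e_smul (k : K) (b : A) : e (κ k * b) = PowerSeries.C k * e b := by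
    ext n
    induction n generalizing b with
    | zero => rw [PowerSeries.coeff_C_mul, e_zero, e_zero, (c_smul k b).1]
    | succ n ih =>
      rw [PowerSeries.coeff_C_mul, e_succ, e_succ, (c_smul k b).2, ih, PowerSeries.coeff_C_mul]
  have e_mul (a b : A) : e (a * b) = e a * e b := by
    ext n
    induction n generalizing a b with
    | zero =>
      rw [PowerSeries.coeff_zero_eq_constantCoeff, map_mul]
      simp only [← PowerSeries.coeff_zero_eq_constantCoeff_apply, e_zero, (c_mul a b).1]
    | succ n ih =>
      rw [e_succ, (c_mul a b).2, e_add, map_add, ih (d a) b, e_smul, PowerSeries.coeff_C_mul]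
      conv_rhs => rw [e_eq a, add_mul, mul_assoc, map_add, PowerSeries.coeff_succ_X_mul,
        PowerSeries.coeff_C_mul, e_succ]
  have e_zero' : e 0 = 0 := by
    have := e_smul 0 0
    simpa using this
  have e_const (k : K) : e (κ k) = PowerSeries.C k := by
    rw [e_eq, (c_const k).1, (c_const k).2, e_zero', mul_zero, add_zero]
  have e_one : e 1 = 1 := by simpa using e_const 1
  refine ⟨⟨⟨⟨e, e_one⟩, e_mul⟩, e_zero', e_add⟩, e_const, ?_⟩
  change e u = _
  rw [e_eq, c_u.1, c_u.2, e_one]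
  simp

theorem zero_le_orderTop_coe (f : PowerSeries K) : 0 ≤ (f : LaurentSeries K).orderTop := by
  refine HahnSeries.le_orderTop_iff_forall.2 fun j hj => ?_
  rw [PowerSeries.coeff_coe]
  have : j < 0 := by exact_mod_cast hj
  simp [this]

theorem algebraMap_laurentSeries (c : K) :
    algebraMap K (LaurentSeries K) c = HahnSeries.C c := by
  rw [HahnSeries.algebraMap_apply', ← HahnSeries.ofPowerSeries_C]
  rfl

theorem orderTop_mul (f g : LaurentSeries K) :
    (f * g).orderTop = f.orderTop + g.orderTop := by
  simpa only [HahnSeries.addVal_apply] using (HahnSeries.addVal ℤ K).map_mul f g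

theorem orderTop_single_one : (HahnSeries.single (1 : ℤ) (1 : K)).orderTop = 1 :=
  HahnSeries.orderTop_single one_ne_zero

variable {E Γ₀ : Type*} [Field E] [Algebra K E] [LinearOrderedCommGroupWithZero Γ₀]
  {v : Valuation E Γ₀}

/-- The valuation `v`, trivial on the residue field `K`, is discrete with uniformizer `u`. -/
structure IsUniformizer (K : Type*) [Field K] [Algebra K E] (v : Valuation E Γ₀) (u : E) :
    Prop where
  const : ∀ c : K, v (algebraMap K E c) ≤ 1
  ne_zero : u ≠ 0
  lt_one : v u < 1
  exists_zpow : ∀ w : E, w ≠ 0 → ∃ k : ℤ, v w = v u ^ k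
  exists_const : ∀ w : E, v w ≤ 1 → ∃ c : K, v (w - algebraMap K E c) < 1

theorem IsUniformizer.val_div_le {u : E} (h : IsUniformizer K v u) {w : E} (hw : v w < 1) :
    v (w / u) ≤ 1 := by
  rcases eq_or_ne w 0 with rfl | hw0
  · simp
  · obtain ⟨k, hk⟩ := h.exists_zpow w hw0
    have hu0 : 0 < v u := by rw [zero_lt_iff, Valuation.ne_zero_iff]; exact h.ne_zero
    have hk1 : 0 < k := by
      rw [hk] at hw
      by_contra! hle
      exact hw.not_ge (one_le_zpow_of_nonpos₀ hu0 h.lt_one.le hle)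
    rw [map_div₀, hk, div_eq_mul_inv, ← zpow_sub_one₀ hu0.ne']
    exact zpow_le_one₀ hu0 h.lt_one.le (by omega)

/-- An embedding into Laurent series that preserves the sign of the order. -/
structure IsOrderEmbedding (v : Valuation E Γ₀) (ψ : E →ₐ[K] LaurentSeries K) : Prop where
  of_le : ∀ w, v w ≤ 1 → 0 ≤ (ψ w).orderTop
  of_lt : ∀ w, v w < 1 → 0 < (ψ w).orderTop
  of_gt : ∀ w, 1 < v w → (ψ w).orderTop < 0

/-- In the valuation ring every element is a constant plus a multiple of u, uniquely because K meets
the maximal ideal only in 0. Iterating this gives power series, and the map extends to the fraction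
field. -/
theorem IsUniformizer.exists_embedding {u : E} (h : IsUniformizer K v u) :
    ∃ ψ : E →ₐ[K] LaurentSeries K, ψ u = HahnSeries.single 1 1 ∧ IsOrderEmbedding v ψ ∧
      ∀ w, v w ≤ 1 → ∃ f : PowerSeries K, ψ w = f := by
  let A := v.valuationSubring
  have hu0 : 0 < v u := by rw [zero_lt_iff, Valuation.ne_zero_iff]; exact h.ne_zero
  let κ : K →+* A := (algebraMap K E).codRestrict A.toSubring h.const
  let uA : A := ⟨u, h.lt_one.le⟩
  have hdec : ∀ a : A, ∃ (k : K) (b : A), a = κ k + uA * b := by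
    rintro ⟨a, ha⟩
    obtain ⟨k, hk⟩ := h.exists_const a ha
    refine ⟨k, ⟨(a - algebraMap K E k) / u, h.val_div_le hk⟩, Subtype.ext ?_⟩
    change a = algebraMap K E k + u * ((a - algebraMap K E k) / u)
    rw [mul_div_cancel₀ _ h.ne_zero]
    ring
  choose c d hcd using hdec
  have huniq : ∀ a k b, a = κ k + uA * b → k = c a ∧ b = d a := by
    intro a k b hab
    have h1 : (algebraMap K E k) + u * (b : E) = algebraMap K E (c a) + u * (d a : E) :=
      congrArg Subtype.val (hab.symm.trans (hcd a))
    have h2 : k = c a := by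
      rw [← sub_eq_zero]
      apply const_eq_zero_of_val_lt_one h.const
      have : algebraMap K E (k - c a) = u * ((d a - b : A) : E) := by
        rw [map_sub]
        change _ = u * ((d a : E) - (b : E))
        linear_combination h1
      rw [this, map_mul]
      exact mul_lt_one_of_lt_of_le h.lt_one (d a - b).2
    refine ⟨h2, Subtype.ext ?_⟩
    rw [h2] at h1
    exact mul_left_cancel₀ h.ne_zero (add_left_cancel h1)
  obtain ⟨ψ₀, hκ, hu⟩ := exists_expansion κ uA c d hcd huniq
  let g : A →+* LaurentSeries K := (HahnSeries.ofPowerSeries ℤ K).comp ψ₀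
  -- By discreteness a non-zero a divides a power of u, and the image of that power is a non-zero
  -- monomial.
  have hinj : Function.Injective g := by
    rw [injective_iff_map_eq_zero]
    intro a ha
    by_contra ha0
    have ha0' : (a : E) ≠ 0 := fun h0 => ha0 (Subtype.ext h0)
    obtain ⟨k, hk⟩ := h.exists_zpow a ha0'
    have hk0 : 0 ≤ k := by
      have := a.2
      change v a ≤ 1 at this
      rw [hk] at this
      by_contra! hlt
      exact this.not_gt (one_lt_zpow_of_neg₀ hu0 h.lt_one hlt)
    lift k to ℕ using hk0
    have hb : v (u ^ k / a) ≤ 1 := by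
      rw [map_div₀, map_pow, hk, zpow_natCast, div_self (pow_ne_zero _ hu0.ne')]
    have : a * ⟨u ^ k / a, hb⟩ = uA ^ k := by
      apply Subtype.ext
      change (a : E) * (u ^ k / a) = u ^ k
      field_simp
    have h3 := congrArg g this
    rw [map_mul, ha, zero_mul, map_pow] at h3
    have h4 : g uA = HahnSeries.single 1 1 := by
      change HahnSeries.ofPowerSeries ℤ K (ψ₀ uA) = _
      rw [hu, HahnSeries.ofPowerSeries_X]
    rw [h4] at h3
    exact pow_ne_zero _ (HahnSeries.single_ne_zero one_ne_zero) h3.symm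
  let ψ : E →+* LaurentSeries K := IsFractionRing.lift hinj
  have hψ (a : A) : ψ a = HahnSeries.ofPowerSeries ℤ K (ψ₀ a) :=
    IsFractionRing.lift_algebraMap hinj a
  have hψu : ψ u = HahnSeries.single 1 1 := by
    have := hψ uA
    rwa [hu, HahnSeries.ofPowerSeries_X] at this
  have hps : ∀ w, v w ≤ 1 → ∃ f : PowerSeries K, ψ w = f := fun w hw => ⟨_, hψ ⟨w, hw⟩⟩
  have hle : ∀ w, v w ≤ 1 → 0 ≤ (ψ w).orderTop := by
    intro w hw
    obtain ⟨f, hf⟩ := hps w hw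
    rw [hf]
    exact zero_le_orderTop_coe f
  have hlt : ∀ w, v w < 1 → 0 < (ψ w).orderTop := by
    intro w hw
    have h1 := hle _ (h.val_div_le hw)
    have h2 : w = u * (w / u) := by rw [mul_div_cancel₀ _ h.ne_zero]
    rw [h2, map_mul, orderTop_mul, hψu, orderTop_single_one]
    exact lt_of_lt_of_le (by norm_num) (add_le_add_right h1 1)
  refine ⟨⟨ψ, fun k => ?_⟩, hψu, ⟨hle, hlt, fun w hw => ?_⟩, hps⟩
  · have := hψ (κ k)
    rw [hκ, HahnSeries.ofPowerSeries_C] at this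
    rw [algebraMap_laurentSeries]
    exact this
  · change (ψ w).orderTop < 0
    have hw0 : w ≠ 0 := by rintro rfl; simp at hw
    have h1 := hlt w⁻¹ (by rw [map_inv₀]; exact inv_lt_one_of_one_lt₀ hw)
    have h2 : (ψ w).orderTop + (ψ w⁻¹).orderTop = 0 := by
      rw [← orderTop_mul, ← map_mul, mul_inv_cancel₀ hw0, map_one, HahnSeries.orderTop_one]
    by_contra! h3
    exact (h1.trans_le (le_add_of_nonneg_left h3)).ne' h2

/-- Power series over an algebraically closed field of characteristic zero have roots. -/
theorem exists_powerSeries_root [IsAlgClosed K] [CharZero K] (f : PowerSeries K)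
    (hf : PowerSeries.constantCoeff f ≠ 0) {e : ℕ} (he : 0 < e) :
    ∃ t : PowerSeries K, t ^ e = f := by
  obtain ⟨c, hc⟩ := IsAlgClosed.exists_pow_nat_eq (PowerSeries.constantCoeff f) he
  have hc0 : c ≠ 0 := by rintro rfl; rw [zero_pow he.ne'] at hc; exact hf hc.symm
  -- Hensel's lemma for X ^ e - f at a root c of the constant term: the derivative e c ^ (e - 1) is
  -- a unit in characteristic zero.
  obtain ⟨t, ht, -⟩ := (IsAdicComplete.henselianRing (PowerSeries K)
    (Ideal.span {PowerSeries.X})).is_henselian (X ^ e - C f) (monic_X_pow_sub_C f he.ne')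
    (PowerSeries.C c) (by
      rw [Ideal.mem_span_singleton, PowerSeries.X_dvd_iff]
      simp [hc]) (by
      have hunit : IsUnit (PowerSeries.C (e * c ^ (e - 1)) : PowerSeries K) := by
        apply IsUnit.map
        rw [isUnit_iff_ne_zero]
        exact mul_ne_zero (by exact_mod_cast he.ne') (pow_ne_zero _ hc0)
      have : eval (PowerSeries.C c) (derivative (X ^ e - C f)) =
          PowerSeries.C (e * c ^ (e - 1)) := by
        simp [derivative_X_pow]
      rw [this]
      exact hunit.map _)
  refine ⟨t, ?_⟩
  have : eval t (X ^ e - C f) = 0 := ht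
  rw [eval_sub, eval_pow, eval_X, eval_C, sub_eq_zero] at this
  exact this

/-- The order of a Laurent series as a multiplicative valuation. -/
def orderVal (K : Type*) [Field K] : Valuation (LaurentSeries K) (Multiplicative (WithTop ℤ)ᵒᵈ) :=
  (HahnSeries.addVal ℤ K).toValuation

theorem orderVal_le_iff {f g : LaurentSeries K} :
    orderVal K f ≤ orderVal K g ↔ g.orderTop ≤ f.orderTop := Iff.rfl

theorem orderVal_le_one_iff {f : LaurentSeries K} : orderVal K f ≤ 1 ↔ 0 ≤ f.orderTop := Iff.rfl

theorem orderVal_lt_one_iff {f : LaurentSeries K} : orderVal K f < 1 ↔ 0 < f.orderTop := Iff.rfl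

theorem orderVal_zpow (u : LaurentSeries K) (hu : u.orderTop = 1) (k : ℤ) :
    orderVal K u ^ k = orderVal K (HahnSeries.single k (1 : K)) := by
  have h1 : orderVal K u = orderVal K (HahnSeries.single 1 (1 : K)) := by
    apply le_antisymm <;> rw [orderVal_le_iff, hu, orderTop_single_one]
  rw [h1, ← map_zpow₀, ← RatFunc.single_zpow k]

/-- Any series of order one may serve as a new parameter, so Laurent series can be re-expanded in
it. -/
theorem isUniformizer_orderVal (u : LaurentSeries K) (hu : u.orderTop = 1) :
    IsUniformizer K (orderVal K) u where
  const c := by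
    rw [orderVal_le_one_iff, algebraMap_laurentSeries]
    rw [← HahnSeries.ofPowerSeries_C]
    exact zero_le_orderTop_coe _
  ne_zero := by
    rintro rfl
    simp at hu
  lt_one := by
    rw [orderVal_lt_one_iff, hu]
    exact one_pos
  exists_zpow w hw := by
    refine ⟨w.order, ?_⟩
    rw [orderVal_zpow u hu]
    apply le_antisymm <;> rw [orderVal_le_iff, HahnSeries.orderTop_single one_ne_zero,
      HahnSeries.order_eq_orderTop_of_ne_zero hw]
  exists_const w hw := by
    rw [orderVal_le_one_iff] at hw
    refine ⟨w.coeff 0, ?_⟩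
    rw [orderVal_lt_one_iff, algebraMap_laurentSeries]
    refine lt_of_lt_of_le (b := ((1 : ℤ) : WithTop ℤ)) (by exact_mod_cast one_pos) ?_
    refine HahnSeries.le_orderTop_iff_forall.2 fun j hj => ?_
    have hj' : j < 1 := by exact_mod_cast hj
    rcases eq_or_ne j 0 with rfl | hj0
    · simp
    · rw [HahnSeries.coeff_sub, HahnSeries.C_apply, HahnSeries.coeff_single_of_ne hj0, sub_zero]
      apply HahnSeries.coeff_eq_zero_of_lt_orderTop
      refine lt_of_lt_of_le ?_ hw
      exact_mod_cast (show j < 0 by omega)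

theorem IsOrderEmbedding.comp {ψ : E →ₐ[K] LaurentSeries K} (hψ : IsOrderEmbedding v ψ)
    {θ : LaurentSeries K →ₐ[K] LaurentSeries K} (hθ : IsOrderEmbedding (orderVal K) θ) :
    IsOrderEmbedding v (θ.comp ψ) where
  of_le w hw := hθ.of_le _ (hψ.of_le w hw)
  of_lt w hw := hθ.of_lt _ (hψ.of_lt w hw)
  of_gt w hw := hθ.of_gt _ (hψ.of_gt w hw)

/-- Any element of positive order becomes a power of the parameter in a suitable expansion. -/
theorem IsUniformizer.exists_embedding_pow [IsAlgClosed K] [CharZero K] {u : E}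
    (h : IsUniformizer K v u) {z : E} (hz0 : z ≠ 0) (hz : v z < 1) :
    ∃ (n : ℕ) (ψ : E →ₐ[K] LaurentSeries K), 0 < n ∧ IsOrderEmbedding v ψ ∧
      ψ z = HahnSeries.single (n : ℤ) 1 := by
  obtain ⟨ψ, hψu, hψ, hps⟩ := h.exists_embedding
  obtain ⟨k, hk⟩ := h.exists_zpow z hz0
  have hu0 : 0 < v u := by rw [zero_lt_iff, Valuation.ne_zero_iff]; exact h.ne_zero
  have hk1 : 0 < k := by
    rw [hk] at hz
    by_contra! hle
    exact hz.not_ge (one_le_zpow_of_nonpos₀ hu0 h.lt_one.le hle)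
  lift k to ℕ using hk1.le
  have hk1 : 0 < k := by exact_mod_cast hk1
  have hw1 : v (z / u ^ k) = 1 := by
    rw [map_div₀, map_pow, hk, zpow_natCast, div_self (pow_ne_zero _ hu0.ne')]
  obtain ⟨f, hf⟩ := hps _ hw1.le
  -- The constant term is the residue of z / u ^ k, an element of value 1.
  have hf0 : PowerSeries.constantCoeff f ≠ 0 := by
    intro h0
    obtain ⟨c, hc⟩ := h.exists_const _ hw1.le
    have hc1 := hψ.of_lt _ hc
    rw [map_sub, AlgHom.commutes, hf, algebraMap_laurentSeries] at hc1
    have hc2 := HahnSeries.coeff_eq_zero_of_lt_orderTop hc1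
    rw [HahnSeries.coeff_sub, PowerSeries.coeff_coe] at hc2
    simp [h0] at hc2
    rw [hc2, map_zero, sub_zero, hw1] at hc
    exact lt_irrefl _ hc
  obtain ⟨t, rfl⟩ := exists_powerSeries_root f hf0 hk1
  have ht0 : PowerSeries.constantCoeff t ≠ 0 := by
    intro h0
    rw [map_pow, h0, zero_pow hk1.ne'] at hf0
    exact hf0 rfl
  have hz' : ψ z = (HahnSeries.single 1 1 * (t : LaurentSeries K)) ^ k := by
    have : z = u ^ k * (z / u ^ k) := by
      rw [mul_div_cancel₀ _ (pow_ne_zero _ h.ne_zero)]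
    rw [this, map_mul, hf, map_pow, hψu, mul_pow, map_pow]
  have ht : (t : LaurentSeries K).orderTop = 0 := by
    refine le_antisymm ?_ (zero_le_orderTop_coe t)
    apply HahnSeries.orderTop_le_of_coeff_ne_zero
    rw [PowerSeries.coeff_coe]
    simpa using ht0
  -- Since z is the k-th power of u t, a series of order one, re-expanding in u t turns z into a
  -- pure k-th power of the parameter.
  obtain ⟨θ, hθu, hθ, -⟩ := (isUniformizer_orderVal (HahnSeries.single 1 1 * (t : LaurentSeries K))
    (by rw [orderTop_mul, ht, orderTop_single_one, add_zero])).exists_embedding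
  refine ⟨k, θ.comp ψ, hk1, hψ.comp hθ, ?_⟩
  rw [AlgHom.comp_apply, hz', map_pow, hθu, HahnSeries.single_pow, one_pow, nsmul_one]

end Expansion

/-! ### From places of a function field to Puiseux branches -/

section Branches

variable {K : Type*} [Field K]
variable {E Γ₀ : Type*} [Field E] [Algebra K E] [LinearOrderedCommGroupWithZero Γ₀]
  {v : Valuation E Γ₀}

theorem val_le_one_of_mem_adjoin (hv : ∀ c : K, v (algebraMap K E c) ≤ 1) {u a : E}
    (hu : v u ≤ 1) (ha : a ∈ Algebra.adjoin K {u}) : v a ≤ 1 := by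
  rw [Algebra.adjoin_singleton_eq_range_aeval] at ha
  obtain ⟨P, rfl⟩ := ha
  exact val_aeval_le_one hv hu P

theorem val_le_one_of_isIntegral (hv : ∀ c : K, v (algebraMap K E c) ≤ 1) {u x : E}
    (hu : v u ≤ 1) (hx : IsIntegral (Algebra.adjoin K {u}) x) : v x ≤ 1 := by
  obtain ⟨q, hq, hqx⟩ := hx
  let f : Algebra.adjoin K {u} →+* v.integer :=
    (Algebra.adjoin K {u}).val.toRingHom.codRestrict v.integer
      fun a => val_le_one_of_mem_adjoin hv hu a.2
  have : IsIntegral v.integer x := ⟨q.map f, hq.map f, by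
    rw [eval₂_map]
    exact hqx⟩
  exact (Valuation.integer.integers v).mem_of_integral this

theorem isPrincipalIdealRing_adjoin (u : E) :
    IsPrincipalIdealRing (Algebra.adjoin K {u}) := by
  have hmem : ∀ P : K[X], aeval u P ∈ Algebra.adjoin K {u} := fun P => aeval_mem_adjoin_singleton K u
  let f : K[X] →+* Algebra.adjoin K {u} :=
    ((aeval u : K[X] →ₐ[K] E).codRestrict (Algebra.adjoin K {u}) hmem).toRingHom
  have hf : Function.Surjective f := by
    rintro ⟨x, hx⟩
    rw [Algebra.adjoin_singleton_eq_range_aeval] at hx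
    obtain ⟨P, hP⟩ := hx
    exact ⟨P, Subtype.ext hP⟩
  exact IsPrincipalIdealRing.of_surjective f hf

/-- A place of an algebraic function field in one variable is discrete. -/
theorem exists_isUniformizer [IsAlgClosed K] [CharZero K]
    (hv : ∀ c : K, v (algebraMap K E c) ≤ 1) {u : E} (hu0 : u ≠ 0) (hu : v u < 1)
    [FiniteDimensional K⟮u⟯ E] : ∃ π : E, IsUniformizer K v π := by
  have : IsPrincipalIdealRing (Algebra.adjoin K {u}) := isPrincipalIdealRing_adjoin u
  have : CharZero K⟮u⟯ := charZero_of_injective_algebraMap (algebraMap K K⟮u⟯).injective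
  -- D is a Dedekind domain with fraction field E, and v is non-negative on it in additive terms.
  -- The center P of v on D is non-zero because it contains u, and v will be compared with the
  -- P-adic valuation V.
  let D := integralClosure (Algebra.adjoin K {u}) E
  have : IsDedekindDomain D := integralClosure.isDedekindDomain (Algebra.adjoin K {u}) K⟮u⟯ E
  have : IsFractionRing D E :=
    integralClosure.isFractionRing_of_finite_extension (A := Algebra.adjoin K {u}) K⟮u⟯ E
  let f : D →+* v.valuationSubring :=
    D.val.toRingHom.codRestrict v.valuationSubring.toSubring
      fun a => val_le_one_of_isIntegral hv hu.le a.2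
  let P : Ideal D := (IsLocalRing.maximalIdeal v.valuationSubring).comap f
  have hvD : ∀ d : D, v d ≤ 1 := fun d => val_le_one_of_isIntegral hv hu.le d.2
  have hP : ∀ d : D, d ∈ P ↔ v d < 1 := by
    intro d
    rw [Ideal.mem_comap, ValuationSubring.valuation_lt_one_iff,
      ← (v.isEquiv_valuation_valuationSubring).lt_one_iff_lt_one]
    rfl
  let uD : D := ⟨u, isIntegral_algebraMap (R := Algebra.adjoin K {u}) (A := E)
    (x := ⟨u, Algebra.self_mem_adjoin_singleton K u⟩)⟩
  have hPbot : P ≠ ⊥ := by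
    intro hbot
    have h1 : uD ∈ P := (hP uD).2 hu
    rw [hbot, Ideal.mem_bot] at h1
    exact hu0 (congrArg Subtype.val h1)
  let 𝔭 : IsDedekindDomain.HeightOneSpectrum D := ⟨P, inferInstance, hPbot⟩
  let V := 𝔭.valuation E
  -- An element integral for V has a denominator outside P, which is a unit for v. Hence units for V
  -- are units for v, and a uniformizer for V is one for v.
  have hle : ∀ w, V w ≤ 1 → v w ≤ 1 ∧ (V w < 1 → v w < 1) := by
    intro w hw
    obtain ⟨n, d, hnd⟩ := 𝔭.exists_primeCompl_mul_eq_of_integer w hw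
    have hd : v (algebraMap D E d) = 1 := by
      refine le_antisymm (hvD d) (not_lt.1 fun hlt => d.2 ((hP d).2 hlt))
    have hwn : v w = v (algebraMap D E n) := by rw [← hnd, map_mul, hd, mul_one]
    refine ⟨hwn.le.trans (hvD n), fun hlt => ?_⟩
    rw [hwn]
    refine (hP n).1 ?_
    change n ∈ 𝔭.asIdeal
    rw [← 𝔭.valuation_lt_one_iff_mem (K := E)]
    change V (algebraMap D E n) < 1
    rw [← hnd, map_mul]
    exact mul_lt_one_of_lt_of_le hlt (𝔭.valuation_le_one _)
  have hone : ∀ w, V w = 1 → v w = 1 := by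
    intro w hw
    have h1 := (hle w hw.le).1
    have h2 := (hle w⁻¹ (by rw [map_inv₀, hw, inv_one])).1
    have hw0 : w ≠ 0 := by rintro rfl; simp at hw
    rw [map_inv₀] at h2
    exact le_antisymm h1 ((inv_le_one₀ (by rwa [zero_lt_iff, Valuation.ne_zero_iff])).1 h2)
  obtain ⟨π, hπ⟩ := 𝔭.valuation_exists_uniformizer E
  have hπ0 : π ≠ 0 := by
    rintro rfl
    rw [map_zero] at hπ
    exact WithZero.exp_ne_zero hπ.symm
  refine ⟨π, hv, hπ0, ?_, fun w hw => ?_, fun w hw => ?_⟩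
  · have : V π < 1 := by
      change 𝔭.valuation E π < 1
      rw [hπ, ← WithZero.exp_zero, WithZero.exp_lt_exp]
      norm_num
    exact (hle π this.le).2 this
  · have hVw : V w ≠ 0 := (Valuation.ne_zero_iff _).2 hw
    refine ⟨-WithZero.log (V w), ?_⟩
    have h1 : V (w / π ^ (-WithZero.log (V w))) = 1 := by
      have hVπ : V π = WithZero.exp (-1) := hπ
      rw [map_div₀, map_zpow₀, hVπ, ← WithZero.exp_zsmul, smul_eq_mul]
      rw [neg_mul_neg, mul_one, WithZero.exp_log hVw, div_self hVw]
    have h2 := hone _ h1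
    rw [map_div₀, map_zpow₀] at h2
    exact (div_eq_one_iff_eq (zpow_ne_zero _ ((Valuation.ne_zero_iff _).2 hπ0))).1 h2
  · exact exists_val_sub_lt_of_isAlgebraic hv hu0 hu hw (Algebra.IsAlgebraic.isAlgebraic w)

/-- Every place of a function field is given by a Puiseux expansion. -/
theorem IsAt.exists_embedding [IsAlgClosed K] [CharZero K]
    (hv : ∀ c : K, v (algebraMap K E c) ≤ 1) {z : E} (hz : Transcendental K z)
    (hfin : FiniteDimensional K⟮z⟯ E) {s : OnePoint K} (hs : IsAt v z s) :
    ∃ (n : ℕ) (ψ : E →ₐ[K] LaurentSeries K), 0 < n ∧ IsOrderEmbedding v ψ ∧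
      ψ z = coordAt s n := by
  rw [← adjoin_localParam z s] at hfin
  obtain ⟨π, hπ⟩ := exists_isUniformizer hv (localParam_ne_zero hz s) hs.val_localParam_lt
  obtain ⟨n, ψ, hn, hψ, h⟩ := hπ.exists_embedding_pow (localParam_ne_zero hz s)
    hs.val_localParam_lt
  refine ⟨n, ψ, hn, hψ, ?_⟩
  induction s using OnePoint.rec with
  | infty =>
    change ψ z⁻¹ = _ at h
    change ψ z = HahnSeries.single (-(n : ℤ)) 1
    rw [← inv_inv (ψ z), ← map_inv₀, h]
    rw [HahnSeries.inv_single, inv_one]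
  | coe a =>
    change ψ (z - algebraMap K E a) = _ at h
    change ψ z = HahnSeries.C a + HahnSeries.single (n : ℤ) 1
    rw [← h, map_sub, AlgHom.commutes, algebraMap_laurentSeries]
    ring

theorem IsOrderEmbedding.centeredAt {ψ : E →ₐ[K] LaurentSeries K} (hψ : IsOrderEmbedding v ψ)
    {w : E} {t : OnePoint K} (ht : IsAt v w t) : CenteredAt (ψ w) t := by
  induction t using OnePoint.rec with
  | infty => exact hψ.of_gt w ht
  | coe a =>
    have := hψ.of_lt _ ht
    rw [map_sub, AlgHom.commutes, algebraMap_laurentSeries] at this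
    exact this

/-- Expand the field at the place so that z becomes the standard coordinate. The image of w is then
a Puiseux root of p, and the order of r along it has the sign dictated by v. -/
theorem isPoleOn_of_one_lt [IsAlgClosed K] [CharZero K]
    (hv : ∀ c : K, v (algebraMap K E c) ≤ 1) {z w : E} (hz : Transcendental K z)
    (hfin : FiniteDimensional K⟮z⟯ E) {p : Poly₂ K} (hzw : MvPolynomial.aeval ![z, w] p = 0)
    {P : curve p} (hs : IsAt v z P.1.1) (ht : IsAt v w P.1.2) {r : Rat₂ K}
    (hr : 1 < v (MvPolynomial.aeval ![z, w] (numer r) / MvPolynomial.aeval ![z, w] (denom r))) :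
    IsPoleOn p r P := by
  obtain ⟨n, ψ, hn, hψ, hψz⟩ := hs.exists_embedding hv hz hfin
  have key (q : Poly₂ K) : ψ (MvPolynomial.aeval ![z, w] q) =
      MvPolynomial.aeval ![coordAt P.1.1 n, ψ w] q := by
    rw [← AlgHom.comp_apply, MvPolynomial.comp_aeval]
    congr 2
    ext i : 1
    fin_cases i
    · exact hψz
    · rfl
  refine ⟨n, ψ w, ⟨hn, ?_, hψ.centeredAt ht⟩, ?_⟩
  · rw [← key, hzw, map_zero]
  · rw [evalBranch, ← key, ← key, ← map_div₀]
    exact hψ.of_gt _ hr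

end Branches

/-! ### Subfields generated by one element -/

section RationalFunctions

variable {K E : Type*} [Field K] [Field E] [Algebra K E]

theorem ratEval_algebraMap (z : E) (hz : Transcendental K z) (q : K[X]) :
    ratEval z hz (algebraMap K[X] (RatFunc K) q) = aeval z q := by
  rw [ratEval_apply, RatFunc.num_algebraMap, RatFunc.denom_algebraMap, map_one, div_one]

theorem ratEval_C (z : E) (hz : Transcendental K z) (c : K) :
    ratEval z hz (RatFunc.C c) = algebraMap K E c := by
  rw [← RatFunc.algebraMap_C, ratEval_algebraMap, aeval_C]

theorem mem_adjoin_iff_exists_ratEval {z : E} (hz : Transcendental K z) {w : E} :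
    w ∈ K⟮z⟯ ↔ ∃ f, ratEval z hz f = w := by
  rw [mem_adjoin_simple_iff]
  constructor
  · rintro ⟨a, b, rfl⟩
    exact ⟨algebraMap _ _ a / algebraMap _ _ b, by
      rw [map_div₀, ratEval_algebraMap, ratEval_algebraMap]⟩
  · rintro ⟨f, rfl⟩
    exact ⟨_, _, ratEval_apply z hz f⟩

/-- z is a root of num(T) - f(z) den(T). If this polynomial were zero, its coefficient in degree deg
den would exhibit f(z) as a constant. -/
theorem isAlgebraic_adjoin_ratEval {z : E} (hz : Transcendental K z) {f : RatFunc K}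
    (hf : ¬ ∃ c, f = RatFunc.C c) : IsAlgebraic K⟮ratEval z hz f⟯ z := by
  let t : K⟮ratEval z hz f⟯ := ⟨ratEval z hz f, mem_adjoin_simple_self K _⟩
  have hd : aeval z f.denom ≠ 0 := fun h => hz ⟨_, f.denom_ne_zero, h⟩
  refine ⟨f.num.map (algebraMap K _) - C t * f.denom.map (algebraMap K _), fun h0 => hf ?_, ?_⟩
  · refine ⟨f.num.coeff f.denom.natDegree / f.denom.leadingCoeff, ?_⟩
    have h1 := congrArg (fun q => coeff q f.denom.natDegree) h0
    simp only [coeff_sub, coeff_map, coeff_C_mul, coeff_zero] at h1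
    have h2 := congrArg (Subtype.val : K⟮ratEval z hz f⟯ → E) h1
    have h3 : algebraMap K E (f.num.coeff f.denom.natDegree) -
        ratEval z hz f * algebraMap K E f.denom.leadingCoeff = 0 := h2
    apply (ratEval z hz).toRingHom.injective
    change ratEval z hz f = ratEval z hz (RatFunc.C _)
    rw [ratEval_C, map_div₀, eq_div_iff]
    · exact (sub_eq_zero.1 h3).symm
    · simpa using f.denom_ne_zero
  · rw [map_sub, map_mul, aeval_C, aeval_map_algebraMap, aeval_map_algebraMap]
    change _ - ratEval z hz f * _ = 0
    rw [ratEval_apply, div_mul_cancel₀ _ hd, sub_self]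

theorem transcendental_ratEval {z : E} (hz : Transcendental K z) {f : RatFunc K}
    (hf : ¬ ∃ c, f = RatFunc.C c) : Transcendental K (ratEval z hz f) := by
  intro h
  apply hz
  have : Algebra.IsAlgebraic K K⟮ratEval z hz f⟯ :=
    isAlgebraic_adjoin_simple (isAlgebraic_iff_isIntegral.1 h)
  exact IsAlgebraic.restrictScalars K (isAlgebraic_adjoin_ratEval hz hf)

theorem isAlgebraic_of_adjoin_le {t z w : E} (h : K⟮t⟯ ≤ K⟮z⟯) (hw : IsAlgebraic K⟮t⟯ w) :
    IsAlgebraic K⟮z⟯ w := by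
  obtain ⟨q, hq, hqw⟩ := hw
  refine ⟨q.map (inclusion h).toRingHom, ?_, ?_⟩
  · rwa [Ne, Polynomial.map_eq_zero]
  · rw [aeval_def, eval₂_map]
    exact hqw

theorem IsAt.unique {Γ₀ : Type*} [LinearOrderedCommGroupWithZero Γ₀] {v : Valuation E Γ₀}
    (hv : ∀ c : K, v (algebraMap K E c) ≤ 1) {z : E} {s s' : OnePoint K}
    (h : IsAt v z s) (h' : IsAt v z s') : s = s' := by
  induction s using OnePoint.rec with
  | infty =>
    induction s' using OnePoint.rec with
    | infty => rfl
    | coe b => exact absurd (val_le_one_of_val_sub_lt hv h') (not_le.2 h)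
  | coe a =>
    induction s' using OnePoint.rec with
    | infty => exact absurd (val_le_one_of_val_sub_lt hv h) (not_le.2 h')
    | coe b =>
      have h1 : v (algebraMap K E (a - b)) < 1 := by
        have : algebraMap K E (a - b) = (z - algebraMap K E b) - (z - algebraMap K E a) := by
          rw [map_sub]; ring
        rw [this]
        exact v.map_sub_lt h' h
      rw [sub_eq_zero.1 (const_eq_zero_of_val_lt_one hv h1)]

end RationalFunctions

/-! ### The function field of the curve -/

section FunctionField

variable {K L Ω : Type*} [Field K] [Field L] [Algebra K L]

/-- `L` is the field of fractions of `K[x,y]/⟨p⟩`. -/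
structure IsFunctionField (p : Poly₂ K) (x y : L) : Prop where
  aeval_eq_zero_iff : ∀ q : Poly₂ K, MvPolynomial.aeval ![x, y] q = 0 ↔ p ∣ q
  exists_div : ∀ l : L, ∃ a b : Poly₂ K,
    l = MvPolynomial.aeval ![x, y] a / MvPolynomial.aeval ![x, y] b

variable {p : Poly₂ K} {x y : L}

theorem polyVar_ne_zero {q : K[X]} (hq : q ≠ 0) (i : Fin 2) : polyVar i q ≠ 0 := by
  intro h
  exact MvPolynomial.transcendental_X K i ⟨q, hq, h⟩

/-- Degrees add up, so a non-zero multiple of p involves the variable j. -/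
theorem not_dvd_polyVar {i j : Fin 2} (hij : i ≠ j) (hp : 0 < p.degreeOf j) {q : K[X]}
    (hq : q ≠ 0) : ¬ p ∣ polyVar i q := by
  rintro ⟨G, hG⟩
  have h0 := polyVar_ne_zero hq i
  have hp0 : p ≠ 0 := by rintro rfl; simp at hp
  have hG0 : G ≠ 0 := by rintro rfl; rw [mul_zero] at hG; exact h0 hG
  have h1 := degreeOf_polyVar_le i j q
  rw [hG, MvPolynomial.degreeOf_mul_eq hp0 hG0, if_neg hij] at h1
  omega

theorem IsFunctionField.transcendental_fst (h : IsFunctionField p x y) (hp : 0 < p.degreeOf 1) :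
    Transcendental K x := by
  rintro ⟨q, hq, hqx⟩
  refine not_dvd_polyVar (i := 0) (j := 1) (by decide) hp hq ?_
  rw [← h.aeval_eq_zero_iff, aeval_polyVar]
  exact hqx

theorem IsFunctionField.transcendental_snd (h : IsFunctionField p x y) (hp : 0 < p.degreeOf 0) :
    Transcendental K y := by
  rintro ⟨q, hq, hqy⟩
  refine not_dvd_polyVar (i := 1) (j := 0) (by decide) hp hq ?_
  rw [← h.aeval_eq_zero_iff, aeval_polyVar]
  exact hqy

theorem mvAeval_mem {E : Type*} [Field E] [Algebra K E] (M : IntermediateField K E) {z w : E}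
    (hz : z ∈ M) (hw : w ∈ M) (q : Poly₂ K) : MvPolynomial.aeval ![z, w] q ∈ M := by
  induction q using MvPolynomial.induction_on with
  | C a => simp [M.algebraMap_mem]
  | add p q hp hq => rw [map_add]; exact add_mem hp hq
  | mul_X p i hp =>
    rw [map_mul, MvPolynomial.aeval_X]
    refine mul_mem hp ?_
    fin_cases i
    exacts [hz, hw]

theorem IsFunctionField.eq_top (h : IsFunctionField p x y) (M : IntermediateField K L)
    (hx : x ∈ M) (hy : y ∈ M) : M = ⊤ := by
  rw [eq_top_iff]
  intro l _
  obtain ⟨a, b, rfl⟩ := h.exists_div l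
  exact div_mem (mvAeval_mem M hx hy a) (mvAeval_mem M hx hy b)

theorem IsFunctionField.finiteDimensional (h : IsFunctionField p x y)
    (hy : IsAlgebraic K⟮x⟯ y) : FiniteDimensional K⟮x⟯ L := by
  have h1 : FiniteDimensional K⟮x⟯ (K⟮x⟯⟮y⟯) :=
    adjoin.finiteDimensional (isAlgebraic_iff_isIntegral.1 hy)
  have h2 : (K⟮x⟯⟮y⟯).restrictScalars K = ⊤ := by
    apply h.eq_top
    · exact IntermediateField.algebraMap_mem (K⟮x⟯⟮y⟯) (⟨x, mem_adjoin_simple_self K x⟩ : K⟮x⟯)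
    · exact mem_adjoin_simple_self K⟮x⟯ y
  have h3 : K⟮x⟯⟮y⟯ = ⊤ := by
    rw [eq_top_iff]
    intro l _
    have : l ∈ (K⟮x⟯⟮y⟯).restrictScalars K := by rw [h2]; exact mem_top
    exact this
  rw [h3] at h1
  exact Module.Finite.equiv (topEquiv (F := K⟮x⟯) (E := L)).toLinearEquiv

variable [Field Ω] [Algebra L Ω] [Algebra K Ω] [IsScalarTower K L Ω]

/-- The algebraic closure of K(t) in Ω contains x and y, hence L, and Ω is algebraic over L. -/
theorem IsFunctionField.isAlgebraic_adjoin [Algebra.IsAlgebraic L Ω] (h : IsFunctionField p x y)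
    {t : Ω} (hx : IsAlgebraic K⟮t⟯ (algebraMap L Ω x)) (hy : IsAlgebraic K⟮t⟯ (algebraMap L Ω y)) :
    Algebra.IsAlgebraic K⟮t⟯ Ω := by
  let M := algebraicClosure K⟮t⟯ Ω
  have hM : ∀ l : L, algebraMap L Ω l ∈ M := by
    intro l
    have h1 := h.eq_top ((M.restrictScalars K).comap (IsScalarTower.toAlgHom K L Ω))
      (mem_algebraicClosure_iff.2 hx) (mem_algebraicClosure_iff.2 hy)
    have : l ∈ (M.restrictScalars K).comap (IsScalarTower.toAlgHom K L Ω) := by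
      rw [h1]; exact mem_top
    exact this
  let j : L →+* M := (algebraMap L Ω).codRestrict M.toSubring hM
  refine ⟨fun w => ?_⟩
  obtain ⟨q, hq, hqw⟩ := (Algebra.IsIntegral.isIntegral (R := L) w)
  have hw : IsIntegral M w := ⟨q.map j, hq.map j, by rw [eval₂_map]; exact hqw⟩
  exact isAlgebraic_iff_isIntegral.2 (isIntegral_trans w hw)

end FunctionField

/-! ### The group of the orbits and averages over conjugates -/

section Averaging

variable {K Ω : Type*} [Field K] [Field Ω] [Algebra K Ω]

/-- The group generated by the automorphisms that fix `x` and those that fix `y`. -/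
def orbitGroup (K : Type*) {Ω : Type*} [Field K] [Field Ω] [Algebra K Ω] (x y : Ω) :
    Subgroup (Ω ≃ₐ[K] Ω) :=
  K⟮x⟯.fixingSubgroup ⊔ K⟮y⟯.fixingSubgroup

theorem mem_orbitGroup_of_left {x y : Ω} {τ : Ω ≃ₐ[K] Ω} (h : τ ∈ K⟮x⟯.fixingSubgroup) :
    τ ∈ orbitGroup K x y := Subgroup.mem_sup_left h

theorem mem_orbitGroup_of_right {x y : Ω} {τ : Ω ≃ₐ[K] Ω} (h : τ ∈ K⟮y⟯.fixingSubgroup) :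
    τ ∈ orbitGroup K x y := Subgroup.mem_sup_right h

/-- Words grow on the right, so that the new generator acts first and fixes x or y before σ is
applied. -/
theorem orbitGroup_induction {x y : Ω} {motive : (Ω ≃ₐ[K] Ω) → Prop} (one : motive 1)
    (left : ∀ σ ∈ orbitGroup K x y, ∀ τ ∈ K⟮x⟯.fixingSubgroup, motive σ → motive (σ * τ))
    (right : ∀ σ ∈ orbitGroup K x y, ∀ τ ∈ K⟮y⟯.fixingSubgroup, motive σ → motive (σ * τ))
    {σ : Ω ≃ₐ[K] Ω} (hσ : σ ∈ orbitGroup K x y) : motive σ := by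
  have hcl : orbitGroup K x y = Subgroup.closure
      ((K⟮x⟯.fixingSubgroup : Set (Ω ≃ₐ[K] Ω)) ∪ K⟮y⟯.fixingSubgroup) := Subgroup.sup_eq_closure _ _
  rw [hcl] at hσ
  induction hσ using Subgroup.closure_induction_right with
  | one => exact one
  | mul_right σ hσ τ hτ ih =>
    rw [← hcl] at hσ
    rcases hτ with hτ | hτ
    · exact left σ hσ τ hτ ih
    · exact right σ hσ τ hτ ih
  | mul_inv_cancel σ hσ τ hτ ih =>
    rw [← hcl] at hσ
    rcases hτ with hτ | hτ
    · exact left σ hσ _ (inv_mem hτ) ih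
    · exact right σ hσ _ (inv_mem hτ) ih

theorem apply_eq_of_mem_fixingSubgroup {z w : Ω} {τ : Ω ≃ₐ[K] Ω} (h : τ ∈ K⟮z⟯.fixingSubgroup)
    (hw : w ∈ K⟮z⟯) : τ w = w :=
  (IntermediateField.mem_fixingSubgroup_iff _ _).1 h w hw

theorem apply_eq_of_mem_orbitGroup {x y t : Ω} (hx : t ∈ K⟮x⟯) (hy : t ∈ K⟮y⟯) {σ : Ω ≃ₐ[K] Ω}
    (hσ : σ ∈ orbitGroup K x y) : σ t = t := by
  refine orbitGroup_induction (motive := fun σ => σ t = t) rfl (fun σ _ τ hτ ih => ?_)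
    (fun σ _ τ hτ ih => ?_) hσ
  · rw [AlgEquiv.mul_apply, apply_eq_of_mem_fixingSubgroup hτ hx, ih]
  · rw [AlgEquiv.mul_apply, apply_eq_of_mem_fixingSubgroup hτ hy, ih]

/-- Ω is an algebraic closure of K(z), hence Galois over it in characteristic zero. -/
theorem mem_adjoin_of_fixed [CharZero K] [IsAlgClosed Ω] {z w : Ω}
    (halg : Algebra.IsAlgebraic K⟮z⟯ Ω) (h : ∀ τ ∈ K⟮z⟯.fixingSubgroup, τ w = w) : w ∈ K⟮z⟯ := by
  have : CharZero K⟮z⟯ := charZero_of_injective_algebraMap (algebraMap K K⟮z⟯).injective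
  have : IsAlgClosure K⟮z⟯ Ω := ⟨inferInstance, halg⟩
  have : Normal K⟮z⟯ Ω := IsAlgClosure.normal K⟮z⟯ Ω
  have : IsGalois K⟮z⟯ Ω := ⟨⟩
  have hr : w ∈ Set.range (algebraMap K⟮z⟯ Ω) := by
    rw [InfiniteGalois.mem_range_algebraMap_iff_fixed]
    intro σ
    refine h (σ.restrictScalars K) ?_
    rw [IntermediateField.mem_fixingSubgroup_iff]
    intro a ha
    exact σ.commutes ⟨a, ha⟩
  obtain ⟨a, rfl⟩ := hr
  exact a.2

/-- The group fixes t, so all conjugates of α are roots of one non-zero polynomial over K[t]. -/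
theorem finite_orbit {x y t α : Ω} (hx : t ∈ K⟮x⟯) (hy : t ∈ K⟮y⟯) (ht : Transcendental K t)
    (hα : IsAlgebraic K⟮t⟯ α) : {β | ∃ σ ∈ orbitGroup K x y, σ α = β}.Finite := by
  obtain ⟨Q, hQ, hQα⟩ := exists_relation_of_isAlgebraic hα
  have hQ' : Q.map (aeval t : K[X] →ₐ[K] Ω).toRingHom ≠ 0 := by
    rwa [Ne, Polynomial.map_eq_zero_iff]
    exact transcendental_iff_injective.1 ht
  refine (Q.map (aeval t : K[X] →ₐ[K] Ω).toRingHom).rootSet_finite Ω |>.subset ?_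
  rintro _ ⟨σ, hσ, rfl⟩
  rw [mem_rootSet_of_ne hQ', coe_aeval_eq_eval, eval_map]
  have h1 := congrArg σ.toRingHom hQα
  rw [hom_eval₂, map_zero] at h1
  have h2 : σ.toAlgHom.toRingHom.comp (aeval t : K[X] →ₐ[K] Ω).toRingHom =
      (aeval t : K[X] →ₐ[K] Ω).toRingHom := by
    ext a
    · simp
    · change σ (aeval t X) = aeval t X
      rw [aeval_X, apply_eq_of_mem_orbitGroup hx hy hσ]
  exact h2 ▸ h1

/-- The mean of the conjugates of `α` approximates `α` at every place at which `α` is congruent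
to its conjugates. -/
theorem exists_mean [CharZero K] [IsAlgClosed Ω] {x y t α : Ω} (hx : t ∈ K⟮x⟯) (hy : t ∈ K⟮y⟯)
    (ht : Transcendental K t) (halg : Algebra.IsAlgebraic K⟮t⟯ Ω)
    (halgx : Algebra.IsAlgebraic K⟮x⟯ Ω) (halgy : Algebra.IsAlgebraic K⟮y⟯ Ω) :
    ∃ h : Ω, h ∈ K⟮x⟯ ∧ h ∈ K⟮y⟯ ∧ ∀ A : ValuationSubring Ω,
      (∀ c : K, A.valuation (algebraMap K Ω c) ≤ 1) →
      (∀ σ ∈ orbitGroup K x y, A.valuation (σ α - α) ≤ 1) → A.valuation (α - h) ≤ 1 := by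
  classical
  have hfin := finite_orbit (α := α) hx hy ht (Algebra.IsAlgebraic.isAlgebraic α)
  let S : Finset Ω := hfin.toFinset
  have hS : ∀ β, β ∈ S ↔ ∃ σ ∈ orbitGroup K x y, σ α = β := fun β => hfin.mem_toFinset
  have hScard : (S.card : K) ≠ 0 := by
    rw [Nat.cast_ne_zero, Finset.card_ne_zero]
    exact ⟨α, (hS α).2 ⟨1, one_mem _, rfl⟩⟩
  have hfix : ∀ τ ∈ orbitGroup K x y, τ (∑ β ∈ S, β) = ∑ β ∈ S, β := by
    intro τ hτ
    rw [map_sum]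
    refine Finset.sum_nbij' (fun β => τ β) (fun β => τ⁻¹ β) ?_ ?_ ?_ ?_ ?_
    · intro β hβ
      obtain ⟨σ, hσ, rfl⟩ := (hS β).1 hβ
      exact (hS _).2 ⟨τ * σ, mul_mem hτ hσ, rfl⟩
    · intro β hβ
      obtain ⟨σ, hσ, rfl⟩ := (hS β).1 hβ
      exact (hS _).2 ⟨τ⁻¹ * σ, mul_mem (inv_mem hτ) hσ, rfl⟩
    · intro β _
      exact τ.symm_apply_apply β
    · intro β _
      exact τ.apply_symm_apply β
    · intro β _
      rfl
  have hmem : ∀ z : Ω, Algebra.IsAlgebraic K⟮z⟯ Ω →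
      (∀ τ ∈ K⟮z⟯.fixingSubgroup, τ ∈ orbitGroup K x y) →
      algebraMap K Ω (S.card : K)⁻¹ * ∑ β ∈ S, β ∈ K⟮z⟯ := by
    intro z hz hle
    refine mul_mem (IntermediateField.algebraMap_mem _ _) (mem_adjoin_of_fixed hz fun τ hτ => ?_)
    exact hfix τ (hle τ hτ)
  refine ⟨_, hmem x halgx fun τ hτ => mem_orbitGroup_of_left hτ,
    hmem y halgy fun τ hτ => mem_orbitGroup_of_right hτ, fun A hA hσ => ?_⟩
  -- The difference of α and the mean is the mean of the differences α - β, and the factor 1/|S| is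
  -- a constant.
  have e : α - algebraMap K Ω (S.card : K)⁻¹ * ∑ β ∈ S, β =
      algebraMap K Ω (S.card : K)⁻¹ * ∑ β ∈ S, (α - β) := by
    rw [Finset.sum_sub_distrib, Finset.sum_const, nsmul_eq_mul, mul_sub, ← mul_assoc,
      ← map_natCast (algebraMap K Ω), ← map_mul, inv_mul_cancel₀ hScard, map_one, one_mul]
  rw [e, map_mul]
  refine mul_le_one' (hA _) (A.valuation.map_sum_le fun β hβ => ?_)
  obtain ⟨σ, hσ', rfl⟩ := (hS β).1 hβ
  rw [Valuation.map_sub_swap]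
  exact hσ σ hσ'

/-- Telescoping along a word: a τ over K(x) leaves α alone, and a τ over K(y) leaves β alone, so
that στα - σα = στ(α - β) - σ(α - β) is bounded. -/
theorem val_conj_sub_le {Γ₀ : Type*} [LinearOrderedCommGroupWithZero Γ₀] {v : Valuation Ω Γ₀}
    {x y α β : Ω} (hα : α ∈ K⟮x⟯) (hβ : β ∈ K⟮y⟯)
    (h : ∀ σ ∈ orbitGroup K x y, v (σ (α - β)) ≤ 1) {σ : Ω ≃ₐ[K] Ω} (hσ : σ ∈ orbitGroup K x y) :
    v (σ α - α) ≤ 1 := by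
  refine orbitGroup_induction (motive := fun σ => v (σ α - α) ≤ 1) (by simp)
    (fun σ _ τ hτ ih => ?_) (fun σ hσ τ hτ ih => ?_) hσ
  · rwa [AlgEquiv.mul_apply, apply_eq_of_mem_fixingSubgroup hτ hα]
  · have h1 := h σ hσ
    have h2 := h (σ * τ) (mul_mem hσ (mem_orbitGroup_of_right hτ))
    rw [map_sub, AlgEquiv.mul_apply, AlgEquiv.mul_apply, apply_eq_of_mem_fixingSubgroup hτ hβ] at h2
    rw [map_sub] at h1
    have e : (σ * τ) α - α = (σ (τ α) - σ β) - (σ α - σ β) + (σ α - α) := by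
      rw [AlgEquiv.mul_apply]; ring
    rw [e]
    exact v.map_add_le (v.map_sub_le h2 h1) ih

end Averaging

/-! ### Conjugate places and orbits on the curve -/

section Orbits

theorem aeval_algHom_pair {K L Ω : Type*} [Field K] [Field L] [Algebra K L] [Field Ω]
    [Algebra K Ω] {x y : L} (q : Poly₂ K) (φ : L →ₐ[K] Ω) :
    MvPolynomial.aeval ![φ x, φ y] q = φ (MvPolynomial.aeval ![x, y] q) := by
  rw [← AlgHom.comp_apply, MvPolynomial.comp_aeval]
  congr 2
  ext i : 1
  fin_cases i <;> rfl

variable {K L Ω : Type*} [Field K] [Field L] [Algebra K L] [Field Ω] [Algebra L Ω] [Algebra K Ω]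
  [IsScalarTower K L Ω] {p : Poly₂ K} {x y : L}
  {Γ₀ : Type*} [LinearOrderedCommGroupWithZero Γ₀] {v : Valuation Ω Γ₀}

theorem transcendental_algebraMap {x : L} (hx : Transcendental K x) :
    Transcendental K (algebraMap L Ω x) :=
  (transcendental_algebraMap_iff (algebraMap L Ω).injective).2 hx

/-- The centers of the conjugates of a place make up part of one orbit. -/
theorem exists_center [IsAlgClosed K] [CharZero K] (h : IsFunctionField p x y)
    (hx : Transcendental K x) (hfin : FiniteDimensional K⟮x⟯ L)
    (hv : ∀ c : K, v (algebraMap K Ω c) ≤ 1) (hval : ∀ w : Ω, ∃ s : OnePoint K, IsAt v w s)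
    (r : Rat₂ K) :
    ∃ P : curve p, IsAt v (algebraMap L Ω x) P.1.1 ∧ IsAt v (algebraMap L Ω y) P.1.2 ∧
      (P ∉ specialOrbits p r → ∀ σ ∈ orbitGroup K (algebraMap L Ω x) (algebraMap L Ω y),
        v (σ (algebraMap L Ω (MvPolynomial.aeval ![x, y] (numer r) /
          MvPolynomial.aeval ![x, y] (denom r)))) ≤ 1) := by
  choose s hs using hval
  let φ (σ : Ω ≃ₐ[K] Ω) : L →ₐ[K] Ω := σ.toAlgHom.comp (IsScalarTower.toAlgHom K L Ω)
  have hp0 : MvPolynomial.aeval ![x, y] p = 0 := (h.aeval_eq_zero_iff p).2 dvd_rfl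
  -- P σ is the center of the conjugate place v∘σ.
  let P (σ : Ω ≃ₐ[K] Ω) : curve p := ⟨(s (σ (algebraMap L Ω x)), s (σ (algebraMap L Ω y))),
    mem_curve_of_isAt hv (by
      have := aeval_algHom_pair (x := x) (y := y) p (φ σ)
      rw [hp0, map_zero] at this
      exact this) (hs _) (hs _)⟩
  have horb : ∀ σ ∈ orbitGroup K (algebraMap L Ω x) (algebraMap L Ω y), SameOrbit p (P σ) (P 1) := by
    intro σ hσ
    refine orbitGroup_induction (motive := fun σ => SameOrbit p (P σ) (P 1))
      (Relation.EqvGen.refl _) (fun σ _ τ hτ ih => ?_) (fun σ _ τ hτ ih => ?_) hσ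
    · refine Relation.EqvGen.trans _ _ _ (Relation.EqvGen.rel _ _ (Or.inl ?_)) ih
      change s (σ (τ _)) = s (σ _)
      rw [apply_eq_of_mem_fixingSubgroup hτ (mem_adjoin_simple_self K _)]
    · refine Relation.EqvGen.trans _ _ _ (Relation.EqvGen.rel _ _ (Or.inr ?_)) ih
      change s (σ (τ _)) = s (σ _)
      rw [apply_eq_of_mem_fixingSubgroup hτ (mem_adjoin_simple_self K _)]
  refine ⟨P 1, hs _, hs _, fun hP σ hσ => ?_⟩
  by_contra! hgt
  -- If σ(r) is infinite at v, then r is infinite at the restriction of v∘σ to L, which makes P σ a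
  -- pole of r in the orbit of P 1.
  refine hP ⟨P σ, horb σ hσ, Or.inl ?_⟩
  have hcomap (c : K) : φ σ (algebraMap K L c) = algebraMap K Ω c := (φ σ).commutes c
  have hat (l : L) (t : OnePoint K) (ht : IsAt v (φ σ l) t) :
      IsAt (v.comap (φ σ).toRingHom) l t := by
    induction t using OnePoint.rec with
    | infty => exact ht
    | coe a =>
      have ht' : v (φ σ l - algebraMap K Ω a) < 1 := ht
      rw [← hcomap, ← map_sub] at ht'
      exact ht'
  refine isPoleOn_of_one_lt (v := v.comap (φ σ).toRingHom) (fun c => ?_) hx hfin hp0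
    (hat x _ (hs _)) (hat y _ (hs _)) hgt
  change v (φ σ (algebraMap K L c)) ≤ 1
  rw [hcomap]
  exact hv c

end Orbits

/-! ### Evaluating rational functions on the curve -/

section LocalRing

variable {K L : Type*} [Field K] [Field L] [Algebra K L] {p : Poly₂ K} {x y : L}

/-- The value at `(x, y)` of a bivariate rational function. -/
def evalAt (x y : L) (r : Rat₂ K) : L :=
  MvPolynomial.aeval ![x, y] (numer r) / MvPolynomial.aeval ![x, y] (denom r)

theorem mul_denom_eq (r : Rat₂ K) :
    r * algebraMap (Poly₂ K) (Rat₂ K) (denom r) = algebraMap (Poly₂ K) (Rat₂ K) (numer r) := by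
  have h := IsFractionRing.mk'_num_den' (Poly₂ K) r
  have hd : algebraMap (Poly₂ K) (Rat₂ K) (denom r) ≠ 0 :=
    IsFractionRing.to_map_ne_zero_of_mem_nonZeroDivisors (IsFractionRing.den (Poly₂ K) r).2
  rw [← eq_div_iff hd]
  exact h.symm

/-- The reduced denominator divides every denominator, so the value in L may be computed from any
fraction whose denominator is prime to p. -/
theorem IsFunctionField.evalAt_eq (h : IsFunctionField p x y) {r : Rat₂ K} {a b : Poly₂ K}
    (hb : ¬ p ∣ b)
    (hr : r * algebraMap (Poly₂ K) (Rat₂ K) b = algebraMap (Poly₂ K) (Rat₂ K) a) :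
    r ∈ localRing p ∧
      evalAt x y r = MvPolynomial.aeval ![x, y] a / MvPolynomial.aeval ![x, y] b := by
  have hcross : numer r * b = a * denom r := by
    apply IsFractionRing.injective (Poly₂ K) (Rat₂ K)
    rw [map_mul, map_mul, ← mul_denom_eq, ← hr]
    ring
  have hdvd : denom r ∣ b := by
    have hrel := IsFractionRing.num_den_reduced (Poly₂ K) r
    exact hrel.symm.dvd_of_dvd_mul_left ⟨a, by rw [hcross, mul_comm]⟩
  have hloc : ¬ p ∣ denom r := fun hp => hb (hp.trans hdvd)
  refine ⟨hloc, ?_⟩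
  have h1 : MvPolynomial.aeval ![x, y] (denom r) ≠ 0 := fun h0 =>
    hloc ((h.aeval_eq_zero_iff _).1 h0)
  have h2 : MvPolynomial.aeval ![x, y] b ≠ 0 := fun h0 => hb ((h.aeval_eq_zero_iff _).1 h0)
  rw [evalAt, div_eq_div_iff h1 h2, ← map_mul, hcross, map_mul]

/-- The ideal ⟨p⟩ is the kernel of evaluation from the local ring to L. -/
theorem IsFunctionField.mem_idealOf_iff (h : IsFunctionField p x y) {r : Rat₂ K}
    (hr : r ∈ localRing p) : r ∈ idealOf p ↔ evalAt x y r = 0 := by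
  have hd : algebraMap (Poly₂ K) (Rat₂ K) (denom r) ≠ 0 :=
    IsFractionRing.to_map_ne_zero_of_mem_nonZeroDivisors (IsFractionRing.den (Poly₂ K) r).2
  constructor
  · rintro ⟨q, hq, hqr⟩
    have := (h.evalAt_eq (r := r) (a := numer q * p) (b := denom q) hq (by
      rw [map_mul, ← mul_denom_eq, hqr]
      ring)).2
    rw [this, map_mul, (h.aeval_eq_zero_iff p).2 dvd_rfl, mul_zero, zero_div]
  · intro h0
    have h1 : MvPolynomial.aeval ![x, y] (denom r) ≠ 0 := fun h0 =>
      hr ((h.aeval_eq_zero_iff _).1 h0)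
    obtain ⟨n, hn⟩ := (h.aeval_eq_zero_iff _).1 ((div_eq_zero_iff.1 h0).resolve_right h1)
    refine ⟨algebraMap _ _ n / algebraMap _ _ (denom r),
      (h.evalAt_eq (a := n) (b := denom r) hr (div_mul_cancel₀ _ hd)).1, ?_⟩
    rw [div_mul_eq_mul_div, eq_div_iff hd, mul_denom_eq, hn, map_mul, mul_comm]

theorem IsFunctionField.evalAt_sub (h : IsFunctionField p x y) (hp : Prime p) {r s : Rat₂ K}
    (hr : r ∈ localRing p) (hs : s ∈ localRing p) :
    r - s ∈ localRing p ∧ evalAt x y (r - s) = evalAt x y r - evalAt x y s := by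
  have h1 : MvPolynomial.aeval ![x, y] (denom r) ≠ 0 := fun h0 =>
    hr ((h.aeval_eq_zero_iff _).1 h0)
  have h2 : MvPolynomial.aeval ![x, y] (denom s) ≠ 0 := fun h0 =>
    hs ((h.aeval_eq_zero_iff _).1 h0)
  have key := h.evalAt_eq (r := r - s) (a := numer r * denom s - numer s * denom r)
    (b := denom r * denom s) (fun hd => (hp.dvd_or_dvd hd).elim hr hs) (by
      rw [map_sub, map_mul, map_mul, map_mul, ← mul_denom_eq, ← mul_denom_eq]
      ring)
  refine ⟨key.1, ?_⟩
  rw [key.2, evalAt, evalAt, map_sub, map_mul, map_mul, map_mul]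
  field_simp

theorem polyIn_eq (i : Fin 2) (q : K[X]) :
    polyIn K i q = algebraMap (Poly₂ K) (Rat₂ K) (polyVar i q) := by
  rw [polyIn, polyVar, aeval_algebraMap_apply]

theorem IsFunctionField.evalAt_ratIn (h : IsFunctionField p x y) (i : Fin 2)
    (hz : Transcendental K ((![x, y] : Fin 2 → L) i)) (f : RatFunc K) :
    ratIn K i f ∈ localRing p ∧ evalAt x y (ratIn K i f) = ratEval _ hz f := by
  have hd : MvPolynomial.aeval ![x, y] (polyVar i f.denom) ≠ 0 := by
    rw [aeval_polyVar]
    exact fun h0 => hz ⟨_, f.denom_ne_zero, h0⟩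
  have hb : ¬ p ∣ polyVar i f.denom := fun h0 => hd ((h.aeval_eq_zero_iff _).2 h0)
  have key := h.evalAt_eq (r := ratIn K i f) (a := polyVar i f.num) (b := polyVar i f.denom) hb (by
    have h1 : ratIn K i f = polyIn K i f.num / polyIn K i f.denom := RatFunc.liftAlgHom_apply _ _ _
    have h2 : polyIn K i f.denom ≠ 0 := by
      rw [Ne, map_eq_zero_iff _ (polyIn_injective K i)]
      exact f.denom_ne_zero
    rw [h1, ← polyIn_eq, ← polyIn_eq, div_mul_cancel₀ _ h2])
  refine ⟨key.1, ?_⟩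
  rw [key.2, aeval_polyVar, aeval_polyVar, ratEval_apply]

theorem IsFunctionField.mem_F_iff (h : IsFunctionField p x y) (hp : Prime p)
    (hx : Transcendental K x) (hy : Transcendental K y) {r : Rat₂ K} (hr : r ∈ localRing p)
    (f g : RatFunc K) : (f, g) ∈ F r p ↔ ratEval x hx f - ratEval y hy g = evalAt x y r := by
  obtain ⟨h1, h2⟩ := h.evalAt_ratIn 0 hx f
  obtain ⟨h3, h4⟩ := h.evalAt_ratIn 1 hy g
  obtain ⟨h5, h6⟩ := h.evalAt_sub hp h1 h3
  obtain ⟨h7, h8⟩ := h.evalAt_sub hp h5 hr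
  change ratIn K 0 f - ratIn K 1 g - r ∈ idealOf p ↔ _
  rw [h.mem_idealOf_iff h7, h8, h6, h2, h4, sub_eq_zero]
  rfl

theorem IsFunctionField.mem_F_zero_iff (h : IsFunctionField p x y) (hp : Prime p)
    (hx : Transcendental K x) (hy : Transcendental K y) (f g : RatFunc K) :
    (f, g) ∈ F 0 p ↔ ratEval x hx f = ratEval y hy g := by
  have h0 := h.evalAt_eq (r := 0) (a := 0) (b := 1) (fun hd => hp.not_isUnit (isUnit_of_dvd_one hd))
    (by simp)
  rw [h.mem_F_iff hp hx hy h0.1, h0.2, map_zero, zero_div, sub_eq_zero]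

theorem IsFunctionField.dvd_separatedNumer (h : IsFunctionField p x y)
    (hx : Transcendental K x) (hy : Transcendental K y) {f g : RatFunc K}
    (hfg : ratEval x hx f = ratEval y hy g) : p ∣ separatedNumer f g := by
  rw [← h.aeval_eq_zero_iff, separatedNumer, map_sub, map_mul, map_mul, aeval_polyVar,
    aeval_polyVar, aeval_polyVar, aeval_polyVar, sub_eq_zero]
  have h1 : aeval x f.denom ≠ 0 := fun h0 => hx ⟨_, f.denom_ne_zero, h0⟩
  have h2 : aeval y g.denom ≠ 0 := fun h0 => hy ⟨_, g.denom_ne_zero, h0⟩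
  rw [ratEval_apply, ratEval_apply, div_eq_div_iff h1 h2] at hfg
  exact hfg

end LocalRing

/-! ### Poles of univariate functions and the approximation modulo F(p) -/

section Main

/-- The field of fractions of `K[x,y]/⟨p⟩`. -/
abbrev CurveField {K : Type*} [Field K] (p : Poly₂ K) [(Ideal.span {p}).IsPrime] : Type _ :=
  FractionRing (Poly₂ K ⧸ Ideal.span {p})

/-- The coordinate functions in the function field of the curve. -/
def coordinate {K : Type*} [Field K] (p : Poly₂ K) [(Ideal.span {p}).IsPrime] (i : Fin 2) :
    CurveField p :=
  algebraMap (Poly₂ K ⧸ Ideal.span {p}) (CurveField p) (Ideal.Quotient.mk _ (MvPolynomial.X i))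

theorem isFunctionField_curveField {K : Type*} [Field K] (p : Poly₂ K)
    [(Ideal.span {p}).IsPrime] : IsFunctionField p (coordinate p 0) (coordinate p 1) := by
  have key (q : Poly₂ K) : MvPolynomial.aeval ![coordinate p 0, coordinate p 1] q =
      algebraMap (Poly₂ K ⧸ Ideal.span {p}) (CurveField p) (Ideal.Quotient.mk _ q) := by
    have : MvPolynomial.aeval ![coordinate p 0, coordinate p 1] =
        (IsScalarTower.toAlgHom K (Poly₂ K ⧸ Ideal.span {p}) (CurveField p)).comp
          (Ideal.Quotient.mkₐ K (Ideal.span {p})) := by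
      apply MvPolynomial.algHom_ext
      intro i
      rw [MvPolynomial.aeval_X]
      fin_cases i <;> rfl
    rw [this]
    rfl
  refine ⟨fun q => ?_, fun l => ?_⟩
  · rw [key, map_eq_zero_iff _ (IsFractionRing.injective _ (CurveField p)),
      Ideal.Quotient.eq_zero_iff_mem, Ideal.mem_span_singleton]
  · obtain ⟨a, b, -, hab⟩ := IsFractionRing.div_surjective (A := Poly₂ K ⧸ Ideal.span {p}) l
    obtain ⟨a, rfl⟩ := Ideal.Quotient.mk_surjective a
    obtain ⟨b, rfl⟩ := Ideal.Quotient.mk_surjective b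
    exact ⟨a, b, by rw [key, key, hab]⟩

theorem map_ratEval {K L Ω : Type*} [Field K] [Field L] [Algebra K L] [Field Ω] [Algebra L Ω]
    [Algebra K Ω] [IsScalarTower K L Ω] {z : L} (hz : Transcendental K z) (f : RatFunc K) :
    algebraMap L Ω (ratEval z hz f) = ratEval (algebraMap L Ω z) (transcendental_algebraMap hz) f := by
  rw [ratEval_apply, ratEval_apply, map_div₀, aeval_algebraMap_apply, aeval_algebraMap_apply]

theorem val_aeval_div {K E Γ₀ : Type*} [Field K] [Field E] [Algebra K E]
    [LinearOrderedCommGroupWithZero Γ₀] {v : Valuation E Γ₀}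
    (hv : ∀ c : K, v (algebraMap K E c) ≤ 1) {t : E} (ht : 1 < v t) {H : RatFunc K} (hH : H ≠ 0) :
    v (aeval t H.num / aeval t H.denom) = v t ^ H.intDegree := by
  rw [map_div₀, val_aeval_of_one_lt hv ht (by simpa using hH),
    val_aeval_of_one_lt hv ht H.denom_ne_zero, RatFunc.intDegree,
    zpow_sub₀ (zero_lt_one.trans ht).ne', zpow_natCast, zpow_natCast]

theorem ratEval_eval {K E : Type*} [Field K] [Field E] [Algebra K E] {z : E}
    (hz : Transcendental K z) (H f : RatFunc K) :
    ratEval z hz (H.eval RatFunc.C f) =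
      aeval (ratEval z hz f) H.num / aeval (ratEval z hz f) H.denom := by
  have key (q : K[X]) : ratEval z hz (q.eval₂ RatFunc.C f) = aeval (ratEval z hz f) q := by
    rw [aeval_algHom_apply, aeval_def, RatFunc.algebraMap_eq_C]
  rw [RatFunc.eval, map_div₀, key, key]

/-- Realizes pole multiplicities at s by a valuation on K(X), so that the statements below follow
from the ultrametric inequality. -/
theorem exists_valuation_ratEval {K : Type*} [Field K] (s : OnePoint K) :
    ∃ (A : ValuationSubring (RatFunc K)) (w : A.ValueGroup),
      (∀ c : K, A.valuation (algebraMap K (RatFunc K) c) ≤ 1) ∧ 1 < w ∧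
      (∀ f : RatFunc K, f ≠ 0 →
        A.valuation (ratEval RatFunc.X RatFunc.transcendental_X f) = w ^ mult s f) ∧
      ∀ f, 1 < A.valuation (ratEval RatFunc.X RatFunc.transcendental_X f) ↔ IsPoleOf s f := by
  obtain ⟨A, hA, hs⟩ := exists_valuationSubring_isAt (RatFunc.transcendental_X (K := K)) s
  obtain ⟨w, hw, H⟩ := hs.val_ratEval hA RatFunc.transcendental_X
  exact ⟨A, w, hA, hw, H, hs.one_lt_val_ratEval_iff hA RatFunc.transcendental_X⟩

theorem IsPoleOf.ne_zero {K : Type*} [Field K] {s : OnePoint K} {f : RatFunc K}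
    (h : IsPoleOf s f) : f ≠ 0 := by
  obtain ⟨A, w, -, -, -, hA⟩ := exists_valuation_ratEval s
  rintro rfl
  have := (hA 0).2 h
  rw [map_zero, map_zero] at this
  exact not_lt_zero this

theorem mult_eq_of_not_isPoleOf_sub {K : Type*} [Field K] {s : OnePoint K} {f h : RatFunc K}
    (hh : IsPoleOf s h) (hsub : ¬ IsPoleOf s (f - h)) : mult s f = mult s h := by
  obtain ⟨A, w, -, hw, H, hA⟩ := exists_valuation_ratEval s
  have h0 := hh.ne_zero
  rw [← hA] at hh hsub
  have hv : A.valuation (ratEval RatFunc.X RatFunc.transcendental_X f) =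
      A.valuation (ratEval RatFunc.X RatFunc.transcendental_X h) := by
    have := A.valuation.map_add_eq_of_lt_right ((not_lt.1 hsub).trans_lt hh)
    rwa [← map_add, sub_add_cancel] at this
  have hf0 : f ≠ 0 := by
    rintro rfl
    rw [map_zero, map_zero] at hv
    rw [← hv] at hh
    exact not_lt_zero hh
  rw [H f hf0, H h h0] at hv
  exact zpow_right_injective₀ (zero_lt_one.trans hw) hw.ne' hv

theorem not_isPoleOf_of_sub {K : Type*} [Field K] {s : OnePoint K} {f h : RatFunc K}
    (hh : ¬ IsPoleOf s h) (hsub : ¬ IsPoleOf s (f - h)) : ¬ IsPoleOf s f := by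
  obtain ⟨A, w, -, -, -, hA⟩ := exists_valuation_ratEval s
  rw [← hA, not_lt] at *
  have := A.valuation.map_add_le hsub hh
  rwa [← map_add, sub_add_cancel] at this

/-- Near a pole of f, H(f) grows like the power of f with exponent deg H. The conventions for 0
agree on both sides. -/
theorem mult_eval {K : Type*} [Field K] {s : OnePoint K} {f : RatFunc K} (hf : IsPoleOf s f)
    (H : RatFunc K) : mult s (H.eval RatFunc.C f) = mult s f * H.intDegree := by
  rcases eq_or_ne H 0 with rfl | hH
  · have h1 : mult s (0 : RatFunc K) = 0 := by
      induction s using OnePoint.rec with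
      | infty => exact RatFunc.intDegree_zero
      | coe a => simp [mult]
    rw [RatFunc.eval_zero, RatFunc.intDegree_zero, h1, mul_zero]
  · obtain ⟨A, w, hc, hw, hmult, hA⟩ := exists_valuation_ratEval s
    have hf0 := hf.ne_zero
    rw [← hA] at hf
    have h1 := val_aeval_div hc hf hH
    rw [← ratEval_eval, hmult f hf0, ← zpow_mul] at h1
    have h2 : H.eval RatFunc.C f ≠ 0 := by
      intro h0
      rw [h0, map_zero, map_zero] at h1
      exact zpow_ne_zero _ (zero_lt_one.trans hw).ne' h1.symm
    rw [hmult _ h2] at h1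
    exact zpow_right_injective₀ (zero_lt_one.trans hw) hw.ne' h1

/-- Modulo `F(p)`, the poles of an element of `F(r,p)` lie under special orbits. -/
theorem exists_approximation {K : Type*} [Field K] [IsAlgClosed K] [CharZero K]
    {p : Poly₂ K} (hp : Irreducible p) {L : Type*} [Field L] [Algebra K L] {x y : L}
    (hL : IsFunctionField p x y) (hx : Transcendental K x) (hy : Transcendental K y)
    {r : Rat₂ K} (hr : r ∈ localRing p) (hF : FNontrivial p) {f g : RatFunc K}
    (hfg : (f, g) ∈ F r p) :
    ∃ h₁ h₂ : RatFunc K, (h₁, h₂) ∈ F 0 p ∧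
      (∀ s, ∃ P : curve p, P.1.1 = s ∧ (P ∉ specialOrbits p r → ¬ IsPoleOf s (f - h₁))) ∧
      (∀ s, ∃ P : curve p, P.1.2 = s ∧ (P ∉ specialOrbits p r → ¬ IsPoleOf s (g - h₂))) := by
  let Ω := AlgebraicClosure L
  let X : Ω := algebraMap L Ω x
  let Y : Ω := algebraMap L Ω y
  have hX : Transcendental K X := transcendental_algebraMap hx
  have hY : Transcendental K Y := transcendental_algebraMap hy
  obtain ⟨⟨f₀, g₀⟩, hfg₀, hconst⟩ := hF
  rw [hL.mem_F_zero_iff hp.prime hx hy] at hfg₀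
  rw [hL.mem_F_iff hp.prime hx hy hr] at hfg
  have hf₀ : ¬ ∃ c, f₀ = RatFunc.C c := by
    rintro ⟨c, rfl⟩
    refine hconst ⟨c, Prod.ext rfl ?_⟩
    apply (ratEval y hy).toRingHom.injective
    change ratEval y hy g₀ = ratEval y hy (RatFunc.C c)
    rw [← hfg₀, ratEval_C, ratEval_C]
  have hg₀ : ¬ ∃ c, g₀ = RatFunc.C c := by
    rintro ⟨c, rfl⟩
    refine hf₀ ⟨c, ?_⟩
    apply (ratEval x hx).toRingHom.injective
    change ratEval x hx f₀ = ratEval x hx (RatFunc.C c)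
    rw [hfg₀, ratEval_C, ratEval_C]
  -- y is algebraic over K(g₀(y)), and this field equals K(f₀(x)), a subfield of K(x).
  have hyx : IsAlgebraic K⟮x⟯ y := by
    have h1 := isAlgebraic_adjoin_ratEval hy hg₀
    rw [← hfg₀] at h1
    refine isAlgebraic_of_adjoin_le ?_ h1
    rw [adjoin_simple_le_iff]
    exact (mem_adjoin_iff_exists_ratEval hx).2 ⟨f₀, rfl⟩
  have hfin := hL.finiteDimensional hyx
  have ht : ratEval X hX f₀ = ratEval Y hY g₀ := by
    rw [← map_ratEval hx, ← map_ratEval hy, hfg₀]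
  have htX : ratEval X hX f₀ ∈ K⟮X⟯ := (mem_adjoin_iff_exists_ratEval hX).2 ⟨f₀, rfl⟩
  have htY : ratEval X hX f₀ ∈ K⟮Y⟯ := (mem_adjoin_iff_exists_ratEval hY).2 ⟨g₀, ht.symm⟩
  have halg : Algebra.IsAlgebraic K⟮ratEval X hX f₀⟯ Ω := by
    refine hL.isAlgebraic_adjoin (isAlgebraic_adjoin_ratEval hX hf₀) ?_
    rw [ht]
    exact isAlgebraic_adjoin_ratEval hY hg₀
  have halgX : Algebra.IsAlgebraic K⟮X⟯ Ω :=
    ⟨fun w => isAlgebraic_of_adjoin_le (adjoin_simple_le_iff.2 htX) (halg.isAlgebraic w)⟩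
  have halgY : Algebra.IsAlgebraic K⟮Y⟯ Ω :=
    ⟨fun w => isAlgebraic_of_adjoin_le (adjoin_simple_le_iff.2 htY) (halg.isAlgebraic w)⟩
  -- h is the mean of the conjugates of f(x). Lying in both K(x) and K(y), it gives h₁ and h₂.
  obtain ⟨h, hhX, hhY, hmean⟩ := exists_mean (α := ratEval X hX f) htX htY
    (transcendental_ratEval hX hf₀) halg halgX halgY
  obtain ⟨h₁, hh₁⟩ := (mem_adjoin_iff_exists_ratEval hX).1 hhX
  obtain ⟨h₂, hh₂⟩ := (mem_adjoin_iff_exists_ratEval hY).1 hhY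
  have hρ : algebraMap L Ω (evalAt x y r) = ratEval X hX f - ratEval Y hY g := by
    rw [← hfg, map_sub, map_ratEval hx, map_ratEval hy]
  have main (A : ValuationSubring Ω) (hA : ∀ c : K, A.valuation (algebraMap K Ω c) ≤ 1)
      (hval : ∀ w : Ω, ∃ s : OnePoint K, IsAt A.valuation w s) :
      ∃ P : curve p, IsAt A.valuation X P.1.1 ∧ IsAt A.valuation Y P.1.2 ∧
        (P ∉ specialOrbits p r → A.valuation (ratEval X hX (f - h₁)) ≤ 1 ∧
          A.valuation (ratEval Y hY (g - h₂)) ≤ 1) := by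
    obtain ⟨P, hP1, hP2, hP⟩ := exists_center hL hx hfin hA hval r
    refine ⟨P, hP1, hP2, fun hPs => ?_⟩
    have hσ : ∀ σ ∈ orbitGroup K X Y,
        A.valuation (σ (ratEval X hX f - ratEval Y hY g)) ≤ 1 := by
      rw [← hρ]
      exact hP hPs
    have h1 := hmean A hA fun σ hσ' => val_conj_sub_le
      ((mem_adjoin_iff_exists_ratEval hX).2 ⟨f, rfl⟩)
      ((mem_adjoin_iff_exists_ratEval hY).2 ⟨g, rfl⟩) hσ hσ'
    have h2 := hσ 1 (one_mem _)
    rw [AlgEquiv.one_apply] at h2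
    refine ⟨by rw [map_sub, hh₁]; exact h1, ?_⟩
    -- The bound passes from f to g because r = f(x) - g(y) is itself finite at this place.
    have e : ratEval Y hY (g - h₂) =
        (ratEval X hX f - h) - (ratEval X hX f - ratEval Y hY g) := by
      rw [map_sub, hh₂]; ring
    rw [e]
    exact A.valuation.map_sub_le h1 h2
  refine ⟨h₁, h₂, ?_, fun s => ?_, fun s => ?_⟩
  · rw [hL.mem_F_zero_iff hp.prime hx hy]
    apply (algebraMap L Ω).injective
    rw [map_ratEval hx, map_ratEval hy]
    exact hh₁.trans hh₂.symm
  -- A single place of Ω above x = s is enough, and its center is the required point.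
  · obtain ⟨A, hA, hs⟩ := exists_valuationSubring_isAt hX s
    obtain ⟨P, hP1, -, hP⟩ := main A hA fun w => hs.exists_isAt hA hX (halgX.isAlgebraic w)
    refine ⟨P, hP1.unique hA hs, fun hPs => ?_⟩
    rw [← hs.one_lt_val_ratEval_iff hA hX, not_lt]
    exact (hP hPs).1
  · obtain ⟨A, hA, hs⟩ := exists_valuationSubring_isAt hY s
    obtain ⟨P, -, hP1, hP⟩ := main A hA fun w => hs.exists_isAt hA hY (halgY.isAlgebraic w)
    refine ⟨P, hP1.unique hA hs, fun hPs => ?_⟩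
    rw [← hs.one_lt_val_ratEval_iff hA hY, not_lt]
    exact (hP hPs).2

theorem SameOrbit.mem_specialOrbits {K : Type*} [Field K] {p : Poly₂ K} {r : Rat₂ K}
    {P Q : curve p} (h : SameOrbit p P Q) (hP : P ∈ specialOrbits p r) :
    Q ∈ specialOrbits p r := by
  obtain ⟨R, hR, hR'⟩ := hP
  exact ⟨R, Relation.EqvGen.trans _ _ _ hR h, hR'⟩

/-- Along a common first coordinate nothing changes. Along a common second coordinate the poles of f
are carried over through those of g. -/
theorem SameOrbit.isPoleOf_iff {K : Type*} [Field K] {p : Poly₂ K} (hp : p ≠ 0)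
    {f g : RatFunc K} (hfg : p ∣ separatedNumer f g) {P Q : curve p} (h : SameOrbit p P Q) :
    IsPoleOf P.1.1 f ↔ IsPoleOf Q.1.1 f := by
  induction h with
  | rel P Q h =>
    rcases h with h | h
    · rw [h]
    · rw [isPoleOf_fst_iff_snd hp hfg P.2, isPoleOf_fst_iff_snd hp hfg Q.2, h]
  | refl P => rfl
  | symm P Q _ ih => exact ih.symm
  | trans P Q R _ _ ih ih' => exact ih.trans ih'

end Main
end SeparatedVariables

end

/-! ### The two claims -/

open SeparatedVariables in
theorem mainTheorem2 {K : Type*} [Field K] [IsAlgClosed K] [CharZero K]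
    (p : MvPolynomial (Fin 2) K) (hp : Irreducible p)
    (hpx : 0 < p.degreeOf 0) (hpy : 0 < p.degreeOf 1)
    (r : FractionRing (MvPolynomial (Fin 2) K))
    (hr : r ∈ SeparatedVariables.localRing p) (hr0 : r ∉ SeparatedVariables.idealOf p)
    (hne : (SeparatedVariables.F r p).Nonempty)
    (hF : SeparatedVariables.FNontrivial p) :
    -- some element of `F(r,p)` has all its poles among the orbits of the poles and roots of `r`
    (∃ fg ∈ SeparatedVariables.F r p,
      (∀ s, SeparatedVariables.IsPoleOf s fg.1 →
        ∃ P ∈ SeparatedVariables.specialOrbits p r, P.1.1 = s) ∧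
      (∀ s, SeparatedVariables.IsPoleOf s fg.2 →
        ∃ P ∈ SeparatedVariables.specialOrbits p r, P.1.2 = s)) ∧
    -- and so has, on a given orbit, every element of `F(r,p)` that is reduced at a point of it
    (∀ fg₀, SeparatedVariables.IsGenerator p fg₀ → ∀ fg ∈ SeparatedVariables.F r p,
      ∀ P : SeparatedVariables.curve p, SeparatedVariables.IsPoleOf P.1.1 fg₀.1 →
        (SeparatedVariables.mult P.1.1 fg.1 ≤ 0 ∨
          ¬ SeparatedVariables.mult P.1.1 fg₀.1 ∣ SeparatedVariables.mult P.1.1 fg.1) →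
        ∀ Q : SeparatedVariables.curve p, SeparatedVariables.SameOrbit p P Q →
          (SeparatedVariables.IsPoleOf Q.1.1 fg.1 ∨ SeparatedVariables.IsPoleOf Q.1.2 fg.2) →
          Q ∈ SeparatedVariables.specialOrbits p r) := by
  have : (Ideal.span {p}).IsPrime := (Ideal.span_singleton_prime hp.ne_zero).2 hp.prime
  have hL := isFunctionField_curveField p
  have hx := hL.transcendental_fst hpy
  have hy := hL.transcendental_snd hpx
  constructor
  · obtain ⟨⟨f, g⟩, hfg⟩ := hne
    obtain ⟨h₁, h₂, hh, H₁, H₂⟩ := exists_approximation hp hL hx hy hr hF hfg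
    refine ⟨(f - h₁, g - h₂), ?_, fun s hs => ?_, fun s hs => ?_⟩
    · rw [hL.mem_F_zero_iff hp.prime hx hy] at hh
      rw [hL.mem_F_iff hp.prime hx hy hr] at hfg ⊢
      rw [map_sub, map_sub, hh, sub_sub_sub_cancel_right, hfg]
    · obtain ⟨P, hP, hP'⟩ := H₁ s
      exact ⟨P, by_contra fun hn => hP' hn hs, hP⟩
    · obtain ⟨P, hP, hP'⟩ := H₂ s
      exact ⟨P, by_contra fun hn => hP' hn hs, hP⟩
  · rintro ⟨f₀, g₀⟩ hgen ⟨f, g⟩ hfg P hP hmult Q hPQ hQ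
    by_contra hQs
    obtain ⟨h₁, h₂, hh, H₁, H₂⟩ := exists_approximation hp hL hx hy hr hF hfg
    have hfg₀ : (f₀, g₀) ∈ F 0 p := by
      rw [hgen]
      exact ⟨RatFunc.X, by simp⟩
    rw [hL.mem_F_zero_iff hp.prime hx hy] at hfg₀
    have hdvd := hL.dvd_separatedNumer hx hy hfg₀
    rw [hgen] at hh
    obtain ⟨H, hH⟩ := hh
    obtain ⟨rfl, rfl⟩ := Prod.ext_iff.1 hH
    -- The approximation supplies some point with a prescribed coordinate. Sharing it with a point
    -- of the orbit, that point lies in the orbit too, which is not special.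
    have hregular (R S : curve p) (hR : R.1.1 = S.1.1 ∨ R.1.2 = S.1.2) (hS : SameOrbit p P S) :
        R ∉ specialOrbits p r := fun hRs => hQs <| SameOrbit.mem_specialOrbits
          (Relation.EqvGen.trans _ _ _ (Relation.EqvGen.rel _ _ hR)
            (Relation.EqvGen.trans _ _ _ (Relation.EqvGen.symm _ _ hS) hPQ)) hRs
    -- Otherwise m(s₁,f) would equal m(s₁,H(f₀)) = m(s₁,f₀) deg H, a positive multiple of m(s₁,f₀).
    have hdeg : H.intDegree ≤ 0 := by
      by_contra! hpos
      obtain ⟨R, hR, hR'⟩ := H₁ P.1.1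
      have h1 := hR' (hregular R P (Or.inl hR) (Relation.EqvGen.refl _))
      have h2 := mult_eval hP H
      have h3 : IsPoleOf P.1.1 (H.eval RatFunc.C f₀) := by
        rw [IsPoleOf, h2]
        exact mul_pos hP hpos
      have h4 := mult_eq_of_not_isPoleOf_sub h3 h1
      rcases hmult with hm | hm
      · exact (h4 ▸ hm : mult P.1.1 (H.eval RatFunc.C f₀) ≤ 0).not_gt h3
      · exact hm ⟨_, h4.trans h2⟩
    -- f₀ and g₀ have poles at Q as well, so with deg H ≤ 0 both H(f₀) and H(g₀) are regular there.
    have hQ₁ := (SameOrbit.isPoleOf_iff hp.ne_zero hdvd hPQ).1 hP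
    have hQ₂ := (isPoleOf_fst_iff_snd hp.ne_zero hdvd Q.2).1 hQ₁
    rcases hQ with hQ | hQ
    · obtain ⟨R, hR, hR'⟩ := H₁ Q.1.1
      refine not_isPoleOf_of_sub ?_ (hR' (hregular R Q (Or.inl hR) hPQ)) hQ
      rw [IsPoleOf, mult_eval hQ₁, not_lt]
      exact mul_nonpos_of_nonneg_of_nonpos hQ₁.le hdeg
    · obtain ⟨R, hR, hR'⟩ := H₂ Q.1.2
      refine not_isPoleOf_of_sub ?_ (hR' (hregular R Q (Or.inr hR) hPQ)) hQ
      rw [IsPoleOf, mult_eval hQ₂, not_lt]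
      exact mul_nonpos_of_nonneg_of_nonpos hQ₂.le hdeg
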